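/- Let $f:\mathbb{R}\to\mathbb{R}$ be a compactly supported signal in $L^2(\mathbb{R})$, with Fourier transform $\widehat f(\omega)=\int f(x)e^{-ix\omega}\,dx$ and power spectrum $(Pf)(\omega)=|\widehat f(\omega)|^2$. Assume $Pf\in C^3(\mathbb{R})$ and, for $k=2,3$, that $\omega^k\,\overline{(Pf)}^{(k)}(\omega)\in L^2(\mathbb{R})$, where $\overline{(Pf)}^{(k)}(\omega)=\max_{\xi\in[\omega/2,2\omega]}|(Pf)^{(k)}(\xi)|$ (the interval being $[2\omega,\omega/2]$ for $\omega<0$). Let $\Omega\subset\mathbb{R}$ be a bounded interval. **Model.** For $0<\eta\le 1/\sqrt{12}$, $\sigma>0$ and $M\ge 1$, one observes $y_j=f_j+\varepsilon_j$, $1\le j\le M$, where $f_j(x)=f\big((1-\tau_j)^{-1}(x-t_j)\big)$ and all the observations are supported in $[-\tfrac12,\tfrac12]$; the $t_j$ are independent samples of a real random variable; the $\tau_j$ are independent and uniformly distributed with mean $0$ and variance $\eta^2$; the $\varepsilon_j$ are independent Gaussian white noise processes on $[-\tfrac12,\tfrac12]$ with variance $\sigma^2$; and $(\varepsilon_j)_j$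 is independent of $(t_j,\tau_j)_j$. **Estimator.** Put $C_0=\frac{1-\sqrt3\eta}{1+\sqrt3\eta}$, $C_1=2\sqrt3\,\eta$, $C_2=\frac1{1+\sqrt3\eta}$, $(L_Ch)(\omega)=C^3h(C\omega)$, and $\phi_L(\omega)=(2\pi L^2)^{-1/2}e^{-\omega^2/(2L^2)}$ for a bandwidth $L>0$. With $h=\frac1M\sum_{j=1}^M Py_j-\sigma^2$, where $Py_j=|\widehat{f_j}+\widehat{\varepsilon_j}|^2$, let $$(\widetilde{Pf})(\omega)=(I-L_{C_0})^{-1}C_1L_{C_2}\big[3\,(h*\phi_L)(\omega)+\omega\,(h*\phi_L)'(\omega)\big],\qquad (I-L_{C_0})^{-1}=\sum_{i\ge0}L_{C_0}^i .$$ **Claim.** For every $L_0>0$ there is a constant $C>0$, depending only on $f$, $\Omega$ and $L_0$, such that whenever $M\ge1$, $0<\eta\le 1/\sqrt{12}$, $\sigma\ge1$, $L=(\sigma^4/M)^{1/6}$ and $L\le L_0$, the estimator $\widetilde{Pf}$ is almost surely well defined, its error $\|Pf-\widetilde{Pf}\|_{L^2(\Omega)}$ is a random variable, and $$\mathbb{E}\Big[\|Pf-\widetilde{Pf}\|_{L^2(\Omega)}^2\Big]\le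 C\left[\frac{\eta^2}{M}+\Big(\frac{\sigma^4}{M}\Big)^{2/3}\right].$$ -/

import Mathlib

open MeasureTheory ProbabilityTheory Set
open scoped ENNReal RealInnerProductSpace

noncomputable section

namespace DilationMRA

/-! ### Fourier transform, power spectrum, dilation operators -/

/-- The Fourier transform `∫ f(x) e^{-i x ω} dx` of a real-valued signal. -/
def fourier (f : ℝ → ℝ) (ω : ℝ) : ℂ :=
  ∫ x : ℝ, (f x : ℂ) * Complex.exp (-(Complex.I * x * ω))

/-- The power spectrum `(P f)(ω) = |fourier f ω|²`. -/
def powerSpectrum (f : ℝ → ℝ) (ω : ℝ) : ℝ :=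
  ‖fourier f ω‖ ^ 2

/-- `g ↦ max_{ξ ∈ [ω/2, 2ω]} |g^{(k)}(ξ)|`; for `ω < 0` the interval is `[2ω, ω/2]`. -/
def envelope (g : ℝ → ℝ) (k : ℕ) (ω : ℝ) : ℝ :=
  sSup ((fun ξ => |iteratedDeriv k g ξ|) '' Set.uIcc (ω / 2) (2 * ω))

/-- The dilation operator `(L_C h)(ω) = C³ h(C ω)`. -/
def dilation (C : ℝ) (h : ℝ → ℝ) (ω : ℝ) : ℝ :=
  C ^ 3 * h (C * ω)

/-- The inverse of `I - L_C` for `0 ≤ C < 1`, given by the Neumann series `∑ i, L_C^i h`.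
The series is taken pointwise because it is applied to functions which need not be in `L²(ℝ)`;
it converges at every point when `h` is locally bounded. -/
def oneSubDilationInv (C : ℝ) (h : ℝ → ℝ) (ω : ℝ) : ℝ :=
  ∑' i : ℕ, ((dilation C)^[i] h) ω

/-- `C₀ = (1 - √3 η) / (1 + √3 η)`. -/
def C0 (η : ℝ) : ℝ := (1 - √3 * η) / (1 + √3 * η)

/-- `C₁ = 2 √3 η`. -/
def C1 (η : ℝ) : ℝ := 2 * √3 * η

/-- `C₂ = 1 / (1 + √3 η)`. -/
def C2 (η : ℝ) : ℝ := 1 / (1 + √3 * η)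

/-- The Gaussian filter `φ_L(ω) = (2π L²)^{-1/2} e^{-ω²/(2L²)}`. -/
def gaussianFilter (L ω : ℝ) : ℝ :=
  (√(2 * Real.pi * L ^ 2))⁻¹ * Real.exp (-(ω ^ 2) / (2 * L ^ 2))

/-- The smoothed data `h * φ_L`. -/
def smooth (L : ℝ) (h : ℝ → ℝ) : ℝ → ℝ :=
  convolution h (gaussianFilter L) (ContinuousLinearMap.mul ℝ ℝ) volume

/-- The function `ω ↦ C₁ L_{C₂} [3 (h * φ_L)(ω) + ω (h * φ_L)'(ω)]`. -/
def unbiasedData (η L : ℝ) (h : ℝ → ℝ) (ω : ℝ) : ℝ :=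
  C1 η * dilation (C2 η) (fun u => 3 * smooth L h u + u * deriv (smooth L h) u) ω

/-- Inversion unbiasing of data `h`:
`(I - L_{C₀})⁻¹ C₁ L_{C₂} [3 (h * φ_L)(ω) + ω (h * φ_L)'(ω)]`. -/
def inversionUnbias (η L : ℝ) (h : ℝ → ℝ) : ℝ → ℝ :=
  oneSubDilationInv (C0 η) (unbiasedData η L h)

/-- All the operations in `inversionUnbias η L h` are meaningful: the convolution integral
converges absolutely everywhere, the smoothed data is differentiable, and the Neumann series
converges at every frequency. -/
structure InversionWellDefined (η L : ℝ) (h : ℝ → ℝ) : Prop where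
  convolutionExists :
    ConvolutionExists h (gaussianFilter L) (ContinuousLinearMap.mul ℝ ℝ) volume
  differentiable : Differentiable ℝ (smooth L h)
  summable : ∀ ω : ℝ, Summable fun i : ℕ => ((dilation (C0 η))^[i] (unbiasedData η L h)) ω

/-! ### White noise on the box `[-1/2, 1/2]` -/

/-- The observation box `[-1/2, 1/2]`. -/
abbrev box : Set ℝ := Set.Icc (-(1 / 2)) (1 / 2)

/-- The real Hilbert space `L²([-1/2, 1/2])`. -/
abbrev BoxL2 : Type := Lp ℝ 2 ((volume : Measure ℝ).restrict box)

lemma memLp_cos (ω : ℝ) :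
    MemLp (fun x : ℝ => Real.cos (x * ω)) 2 ((volume : Measure ℝ).restrict box) :=
  MemLp.of_bound (by fun_prop) 1
    (Filter.Eventually.of_forall fun x => by simpa using Real.abs_cos_le_one (x * ω))

lemma memLp_sin (ω : ℝ) :
    MemLp (fun x : ℝ => Real.sin (x * ω)) 2 ((volume : Measure ℝ).restrict box) :=
  MemLp.of_bound (by fun_prop) 1
    (Filter.Eventually.of_forall fun x => by simpa using Real.abs_sin_le_one (x * ω))

variable {S : Type*}

/-- The Fourier transform `ε(e^{-i · ω}) = ε(cos(· ω)) - i ε(sin(· ω))` of a generalized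
process `ε` on the box, where `ε φ` stands for `∫ ε(x) φ(x) dx`. -/
def noiseFourier (ε : BoxL2 → S → ℝ) (ω : ℝ) (s : S) : ℂ :=
  (ε (memLp_cos ω).toLp s : ℂ) - Complex.I * (ε (memLp_sin ω).toLp s : ℂ)

variable [MeasurableSpace S]

/-- `ε` is a (Gaussian) white noise process with variance `σ²` on `[-1/2, 1/2]`: a centred
Gaussian process indexed by `L²([-1/2, 1/2])` with covariance `E[ε(φ) ε(ψ)] = σ² ⟨φ, ψ⟩`.
As usual a version is chosen whose Fourier transform is a measurable process, so that it can be
integrated in the frequency variable. -/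
structure IsWhiteNoise (σ : ℝ) (ε : BoxL2 → S → ℝ) (P : Measure S) : Prop where
  measurable : ∀ φ, Measurable (ε φ)
  gaussian : IsGaussianProcess ε P
  mean_zero : ∀ φ, ∫ s, ε φ s ∂P = 0
  covariance : ∀ φ ψ, ∫ s, ε φ s * ε ψ s ∂P = σ ^ 2 * ⟪φ, ψ⟫
  measurable_fourier : Measurable (Function.uncurry (noiseFourier ε))

/-! ### The noisy dilation MRA data model -/

/-- The translated and dilated signal `x ↦ f((1 - τ)⁻¹ (x - t))`. -/
def dilatedSignal (f : ℝ → ℝ) (τ t x : ℝ) : ℝ := f ((1 - τ)⁻¹ * (x - t))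

/-- The noisy dilation MRA data model with `M` observations `y_j = f_j + ε_j`, where
`f_j(x) = f((1 - τ_j)⁻¹ (x - t_j))`. No assumption is made on the joint law of the
translations and the dilations beyond the ones on each of the two families. -/
structure IsNoisyDilationMRA (f : ℝ → ℝ) (M : ℕ) (η σ : ℝ) (t τ : Fin M → S → ℝ)
    (ε : Fin M → BoxL2 → S → ℝ) (P : Measure S) : Prop where
  /-- the signals are supported in the box; the noise lives on the box by definition -/
  support_subset : ∀ j, ∀ᵐ s ∂P, Function.support (dilatedSignal f (τ j s) (t j s)) ⊆ box
  measurable_t : ∀ j, Measurable (t j)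
  /-- the translations are independent samples of one random variable -/
  indep_t : iIndepFun t P
  identDistrib_t : ∀ i j, IdentDistrib (t i) (t j) P P
  measurable_τ : ∀ j, Measurable (τ j)
  /-- the dilations are independent and uniform with mean `0` and variance `η²` -/
  indep_τ : iIndepFun τ P
  uniform_τ : ∀ j, pdf.IsUniform (τ j) (Set.Icc (-(√3 * η)) (√3 * η)) P volume
  /-- the noises are independent white noise processes -/
  whiteNoise : ∀ j, IsWhiteNoise σ (ε j) P
  indep_ε : iIndepFun (fun j s φ => ε j φ s) P
  /-- the noise is independent of the translations and dilations -/
  indep_signal_noise :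
    IndepFun (fun s j => (t j s, τ j s)) (fun s j φ => ε j φ s) P

variable {M : ℕ}

/-- The power spectrum `(P y_j)(ω)` of the observation `y_j = f_j + ε_j`. -/
def observedPowerSpectrum (f : ℝ → ℝ) (t τ : Fin M → S → ℝ) (ε : Fin M → BoxL2 → S → ℝ)
    (j : Fin M) (s : S) (ω : ℝ) : ℝ :=
  ‖fourier (dilatedSignal f (τ j s) (t j s)) ω + noiseFourier (ε j) ω s‖ ^ 2

/-- The data `(1/M) ∑ j, P y_j - σ²`. -/
def meanPowerSpectrum (f : ℝ → ℝ) (σ : ℝ) (t τ : Fin M → S → ℝ)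
    (ε : Fin M → BoxL2 → S → ℝ) (s : S) (ω : ℝ) : ℝ :=
  (1 / (M : ℝ)) * ∑ j, observedPowerSpectrum f t τ ε j s ω - σ ^ 2

/-- The inversion-unbiased estimator of the power spectrum of `f` for noisy dilation MRA. -/
def estimator (f : ℝ → ℝ) (η σ L : ℝ) (t τ : Fin M → S → ℝ)
    (ε : Fin M → BoxL2 → S → ℝ) (s : S) : ℝ → ℝ :=
  inversionUnbias η L (meanPowerSpectrum f σ t τ ε s)

/-- The error `‖P f - estimator‖_{L²(Ω)}`, as a random variable. -/
def estimationError (f : ℝ → ℝ) (Ω : Set ℝ) (η σ L : ℝ) (t τ : Fin M → S → ℝ)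
    (ε : Fin M → BoxL2 → S → ℝ) (s : S) : ℝ≥0∞ :=
  eLpNorm (fun ω => powerSpectrum f ω - estimator f η σ L t τ ε s ω) 2 (volume.restrict Ω)

end DilationMRA

end

/-!
The estimator is linear in the data, and `I - L_{C₀}` is designed so that the averaged noiseless
data are inverted exactly: with `a = √3 η` and dilation factors `x = 1 - τ` uniform in
`[1 - a, 1 + a]`, the noiseless power spectrum is `q(u) = x² Pf(x u)`, and `3 q(u) + u q'(u)` is
the `x`-derivative of `x³ Pf(x u)`. Its mean is therefore a difference quotient of boundary values
(`integral_dilatedData`), and `C₁ L_{C₂}` turns that into `Pf - L_{C₀} Pf`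
(`C1_mul_dilation_meanUnbiasData`). Hence the error of the estimator at `ω` is a series
`∑ wᵢ G(uᵢ)`, where `G` is the error of the smoothed data `3 k + u k'` relative to that mean,
`|uᵢ| ≤ |ω|`, and the weights sum to at most `3 / 2` uniformly in `η`: the factor `C₁ ~ η` cancels
the norm `~ 1 / η` of the Neumann series (`hasSum_sub_inversionUnbias`, `tsum_seriesWeight_le`).
By the Cauchy-Schwarz inequality it is enough to bound `E |G(u)|²` for each `u` in a bounded
interval `[-R, R]` containing `Ω` (`lintegral_inversionError_sq_le`).

The function `G` has three parts (`enorm_meanUnbiasData_sub_le`).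
* The fluctuation of the dilations. It is an average of `M` independent centred variables which
  are Lipschitz in `τ`, hence of size `O(η)`, so its second moment is `O(η² / M)`
  (`lintegral_average_dilatedData_le`).
* The bias of the smoothing. Since `f` is integrable with compact support, all derivatives of `Pf`
  are bounded (`exists_boundedDerivs_powerSpectrum`), so a symmetric filter of variance `L²` changes
  the noiseless data and their derivative by `O(L²)`.
* The noise. At each frequency the noise part of the data has second moment `O(σ⁴ / M)`, because
  its `M` summands are uncorrelated whatever the joint law of translations and dilations
  (`lintegral_meanNoise_sq_le`). Convolution with `φ_L` and `φ_L'`, whose `L¹` norms are `1` and at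
  most `1 / L`, leaves `O((1 + 1 / L²) σ⁴ / M)`.

As `σ⁴ / M = L⁶` and `L ≤ L₀`, the last two parts are of order `L⁴ = (σ⁴ / M)^{2/3}`.

The uniform second moment of the noise also makes the data almost surely integrable against a
Gaussian weight that dominates all translates of `φ_L` and `φ_L'` (`ae_integrable_meanNoise`). On
that event the convolution is differentiable under the integral sign, the Neumann series converges
geometrically, and the error agrees with a jointly measurable expression
(`inversionError_eq`, `measurable_inversionError`).
-/

noncomputable section

namespace DilationMRA

section

/-! ### Smoothness of the power spectrum of a compactly supported signal -/

/-- The moment `∫ f(x) x^k cos(xω) dx`. -/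
def cosMoment (f : ℝ → ℝ) (k : ℕ) (ω : ℝ) : ℝ := ∫ x, f x * x ^ k * Real.cos (x * ω)

/-- The moment `∫ f(x) x^k sin(xω) dx`. -/
def sinMoment (f : ℝ → ℝ) (k : ℕ) (ω : ℝ) : ℝ := ∫ x, f x * x ^ k * Real.sin (x * ω)

variable {f : ℝ → ℝ}

lemma integrable_mul_pow (hf : HasCompactSupport f) (hf2 : MemLp f 2 volume) (k : ℕ) :
    Integrable (fun x => f x * x ^ k) := by
  have h1 : LocallyIntegrable f volume := hf2.locallyIntegrable (by norm_num)
  have h2 : IntegrableOn (fun x => f x * x ^ k) (tsupport f) :=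
    (h1.integrableOn_isCompact hf).mul_continuousOn (by fun_prop) hf
  refine (integrableOn_iff_integrable_of_support_subset ?_).1 h2
  intro x hx
  exact subset_tsupport f (left_ne_zero_of_mul hx)

lemma integrable_mul_pow_mul {g : ℝ → ℝ} (hi : ∀ k : ℕ, Integrable (fun x => f x * x ^ k)) (k : ℕ)
    (hg : Continuous g) (hb : ∀ x, |g x| ≤ 1) : Integrable (fun x => f x * x ^ k * g x) :=
  (hi k).mul_bdd (c := 1) hg.aestronglyMeasurable
    (Filter.Eventually.of_forall fun x => by simpa using hb x)

lemma abs_integral_mul_pow_mul_le {g : ℝ → ℝ} (hi : ∀ k : ℕ, Integrable (fun x => f x * x ^ k))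
    (k : ℕ) (hb : ∀ x, |g x| ≤ 1) :
    |∫ x, f x * x ^ k * g x| ≤ ∫ x, |f x * x ^ k| := by
  rw [← Real.norm_eq_abs]
  refine norm_integral_le_of_norm_le (hi k).abs (Filter.Eventually.of_forall fun x => ?_)
  rw [Real.norm_eq_abs, abs_mul]
  exact mul_le_of_le_one_right (abs_nonneg _) (hb x)

lemma hasDerivAt_cosMoment (hi : ∀ k : ℕ, Integrable (fun x => f x * x ^ k)) (k : ℕ) (ω : ℝ) :
    HasDerivAt (cosMoment f k) (-sinMoment f (k + 1) ω) ω := by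
  have h := (hasDerivAt_integral_of_dominated_loc_of_deriv_le (μ := volume) (x₀ := ω)
    (F := fun ω x => f x * x ^ k * Real.cos (x * ω))
    (F' := fun ω x => f x * x ^ (k + 1) * -Real.sin (x * ω))
    (bound := fun x => |f x * x ^ (k + 1)|) Filter.univ_mem
    (Filter.Eventually.of_forall fun w => (integrable_mul_pow_mul hi k (by fun_prop)
      (fun x => Real.abs_cos_le_one _)).aestronglyMeasurable)
    (integrable_mul_pow_mul hi k (by fun_prop) (fun x => Real.abs_cos_le_one _))
    (integrable_mul_pow_mul hi (k + 1) (by fun_prop)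
      (fun x => by simpa using Real.abs_sin_le_one _)).aestronglyMeasurable
    (Filter.Eventually.of_forall fun x w _ => by
      rw [Real.norm_eq_abs, abs_mul]
      exact mul_le_of_le_one_right (abs_nonneg _) (by simpa using Real.abs_sin_le_one _))
    (hi (k + 1)).abs
    (Filter.Eventually.of_forall fun x w _ => by
      have := ((hasDerivAt_const_mul (x := w) x).cos).const_mul (f x * x ^ k)
      refine this.congr_deriv ?_
      ring)).2
  refine h.congr_deriv ?_
  rw [sinMoment, ← integral_neg]
  exact integral_congr_ae (Filter.Eventually.of_forall fun x => by simp)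

lemma hasDerivAt_sinMoment (hi : ∀ k : ℕ, Integrable (fun x => f x * x ^ k)) (k : ℕ) (ω : ℝ) :
    HasDerivAt (sinMoment f k) (cosMoment f (k + 1) ω) ω :=
  (hasDerivAt_integral_of_dominated_loc_of_deriv_le (μ := volume) (x₀ := ω)
    (F := fun ω x => f x * x ^ k * Real.sin (x * ω))
    (F' := fun ω x => f x * x ^ (k + 1) * Real.cos (x * ω))
    (bound := fun x => |f x * x ^ (k + 1)|) Filter.univ_mem
    (Filter.Eventually.of_forall fun w => (integrable_mul_pow_mul hi k (by fun_prop)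
      (fun x => Real.abs_sin_le_one _)).aestronglyMeasurable)
    (integrable_mul_pow_mul hi k (by fun_prop) (fun x => Real.abs_sin_le_one _))
    (integrable_mul_pow_mul hi (k + 1) (by fun_prop)
      (fun x => Real.abs_cos_le_one _)).aestronglyMeasurable
    (Filter.Eventually.of_forall fun x w _ => by
      rw [Real.norm_eq_abs, abs_mul]
      exact mul_le_of_le_one_right (abs_nonneg _) (Real.abs_cos_le_one _))
    (hi (k + 1)).abs
    (Filter.Eventually.of_forall fun x w _ => by
      have := ((hasDerivAt_const_mul (x := w) x).sin).const_mul (f x * x ^ k)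
      refine this.congr_deriv ?_
      ring)).2

lemma fourier_eq_moments (hi : ∀ k : ℕ, Integrable (fun x => f x * x ^ k)) (ω : ℝ) :
    fourier f ω = (cosMoment f 0 ω : ℂ) - Complex.I * (sinMoment f 0 ω : ℂ) := by
  have hc := integrable_mul_pow_mul (g := fun x => Real.cos (x * ω)) hi 0 (by fun_prop)
    (fun x => Real.abs_cos_le_one _)
  have hs := integrable_mul_pow_mul (g := fun x => Real.sin (x * ω)) hi 0 (by fun_prop)
    (fun x => Real.abs_sin_le_one _)
  rw [fourier, cosMoment, sinMoment, ← integral_complex_ofReal, ← integral_complex_ofReal,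
    ← integral_const_mul, ← integral_sub hc.ofReal (hs.ofReal.const_mul _)]
  refine integral_congr_ae (Filter.Eventually.of_forall fun x => ?_)
  have : -(Complex.I * x * ω) = ((-(x * ω) : ℝ) : ℂ) * Complex.I := by push_cast; ring
  simp only [this, Complex.exp_mul_I, ← Complex.ofReal_cos, ← Complex.ofReal_sin, Real.cos_neg,
    Real.sin_neg]
  push_cast
  ring

lemma powerSpectrum_eq_moments (hi : ∀ k : ℕ, Integrable (fun x => f x * x ^ k)) (ω : ℝ) :
    powerSpectrum f ω = cosMoment f 0 ω ^ 2 + sinMoment f 0 ω ^ 2 := by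
  rw [powerSpectrum, fourier_eq_moments hi, ← Complex.normSq_eq_norm_sq, Complex.normSq_apply]
  simp
  ring

lemma continuous_fourier (hi : ∀ k : ℕ, Integrable (fun x => f x * x ^ k)) :
    Continuous (fourier f) := by
  have h1 : Continuous (cosMoment f 0) :=
    continuous_iff_continuousAt.2 fun w => (hasDerivAt_cosMoment hi 0 w).continuousAt
  have h2 : Continuous (sinMoment f 0) :=
    continuous_iff_continuousAt.2 fun w => (hasDerivAt_sinMoment hi 0 w).continuousAt
  rw [funext (fourier_eq_moments hi)]
  fun_prop

/-- `p₀, p₁, p₂, p₃` are a function and its first three derivatives, all bounded by `K`. -/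
structure BoundedDerivs (K : ℝ) (p₀ p₁ p₂ p₃ : ℝ → ℝ) : Prop where
  deriv₀ : ∀ x, HasDerivAt p₀ (p₁ x) x
  deriv₁ : ∀ x, HasDerivAt p₁ (p₂ x) x
  deriv₂ : ∀ x, HasDerivAt p₂ (p₃ x) x
  bound₀ : ∀ x, |p₀ x| ≤ K
  bound₁ : ∀ x, |p₁ x| ≤ K
  bound₂ : ∀ x, |p₂ x| ≤ K
  bound₃ : ∀ x, |p₃ x| ≤ K

/-- Compact support of `f` makes every derivative of `f̂` bounded, hence also those of `P f`. -/
lemma exists_boundedDerivs_powerSpectrum (hi : ∀ k : ℕ, Integrable (fun x => f x * x ^ k)) :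
    ∃ K p₁ p₂ p₃, BoundedDerivs K (powerSpectrum f) p₁ p₂ p₃ := by
  set c := cosMoment f with hc
  set s := sinMoment f with hs
  have dc := hasDerivAt_cosMoment hi
  have ds := hasDerivAt_sinMoment hi
  have bc : ∀ k w, |c k w| ≤ ∫ x, |f x * x ^ k| := fun k w =>
    abs_integral_mul_pow_mul_le hi k fun x => Real.abs_cos_le_one _
  have bs : ∀ k w, |s k w| ≤ ∫ x, |f x * x ^ k| := fun k w =>
    abs_integral_mul_pow_mul_le hi k fun x => Real.abs_sin_le_one _
  rw [← hc] at dc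
  rw [← hs] at ds
  rw [← hc, ← hs] at *
  obtain ⟨A, hA⟩ : ∃ A : ℝ, ∀ k ≤ 3, (∫ x, |f x * x ^ k|) ≤ A := by
    refine ⟨∑ k ∈ Finset.range 4, ∫ x, |f x * x ^ k|, fun k hk => ?_⟩
    exact Finset.single_le_sum (f := fun k => ∫ x, |f x * x ^ k|)
      (fun i _ => integral_nonneg fun x => abs_nonneg _) (Finset.mem_range.2 (by omega))
  have hm : ∀ {a b : ℝ}, |a| ≤ A → |b| ≤ A → |a * b| ≤ A ^ 2 := fun {a b} ha hb => by
    rw [abs_mul, sq]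
    exact mul_le_mul ha hb (abs_nonneg _) ((abs_nonneg _).trans ha)
  have C0 := fun w => (bc 0 w).trans (hA 0 (by omega))
  have C1 := fun w => (bc 1 w).trans (hA 1 (by omega))
  have C2 := fun w => (bc 2 w).trans (hA 2 (by omega))
  have C3 := fun w => (bc 3 w).trans (hA 3 (by omega))
  have S0 := fun w => (bs 0 w).trans (hA 0 (by omega))
  have S1 := fun w => (bs 1 w).trans (hA 1 (by omega))
  have S2 := fun w => (bs 2 w).trans (hA 2 (by omega))
  have S3 := fun w => (bs 3 w).trans (hA 3 (by omega))
  refine ⟨16 * A ^ 2, fun w => 2 * (s 0 w * c 1 w - c 0 w * s 1 w),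
    fun w => 2 * (c 1 w * c 1 w + s 1 w * s 1 w - s 0 w * s 2 w - c 0 w * c 2 w),
    fun w => 2 * (3 * (s 1 w * c 2 w) - 3 * (c 1 w * s 2 w) - s 0 w * c 3 w + c 0 w * s 3 w),
    ?_, ?_, ?_, ?_, ?_, ?_, ?_⟩
  · intro w
    rw [funext (powerSpectrum_eq_moments hi)]
    refine (((dc 0 w).pow 2).add ((ds 0 w).pow 2)).congr_deriv ?_
    simp only [zero_add]
    ring
  · intro w
    refine ((((ds 0 w).mul (dc 1 w)).sub ((dc 0 w).mul (ds 1 w))).const_mul 2).congr_deriv ?_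
    simp only [zero_add]
    ring
  · intro w
    refine ((((((dc 1 w).mul (dc 1 w)).add ((ds 1 w).mul (ds 1 w))).sub
      ((ds 0 w).mul (ds 2 w))).sub ((dc 0 w).mul (dc 2 w))).const_mul 2).congr_deriv ?_
    simp only [zero_add]
    ring
  · intro w
    rw [powerSpectrum_eq_moments hi]
    have h1 := abs_le.1 (hm (C0 w) (C0 w))
    have h2 := abs_le.1 (hm (S0 w) (S0 w))
    rw [abs_le]; constructor <;> nlinarith
  · intro w
    have h1 := abs_le.1 (hm (S0 w) (C1 w))
    have h2 := abs_le.1 (hm (C0 w) (S1 w))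
    rw [abs_le]; constructor <;> linarith
  · intro w
    have h1 := abs_le.1 (hm (C1 w) (C1 w))
    have h2 := abs_le.1 (hm (S1 w) (S1 w))
    have h3 := abs_le.1 (hm (S0 w) (S2 w))
    have h4 := abs_le.1 (hm (C0 w) (C2 w))
    rw [abs_le]; constructor <;> linarith
  · intro w
    have h1 := abs_le.1 (hm (S1 w) (C2 w))
    have h2 := abs_le.1 (hm (C1 w) (S2 w))
    have h3 := abs_le.1 (hm (S0 w) (C3 w))
    have h4 := abs_le.1 (hm (C0 w) (S3 w))
    rw [abs_le]; constructor <;> linarith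

/-! ### Fourier transform of a translated and dilated signal -/

lemma fourier_dilatedSignal {τ : ℝ} (hτ : τ < 1) (t ω : ℝ) :
    fourier (dilatedSignal f τ t) ω =
      ((1 - τ : ℝ) : ℂ) * Complex.exp (((-(t * ω) : ℝ) : ℂ) * Complex.I) *
        fourier f ((1 - τ) * ω) := by
  have hb : (0 : ℝ) < 1 - τ := by linarith
  have h := integral_sub_right_eq_self (μ := volume)
    (fun x : ℝ => (f ((1 - τ)⁻¹ * x) : ℂ) * Complex.exp (-(Complex.I * (x + t : ℝ) * ω))) t
  have h2 := Measure.integral_comp_mul_left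
    (fun y : ℝ => (f y : ℂ) * Complex.exp (-(Complex.I * ((1 - τ) * y + t : ℝ) * ω))) (1 - τ)⁻¹
  simp only [sub_add_cancel] at h
  rw [fourier]
  simp only [dilatedSignal]
  rw [h]
  have hne : (1 - τ) ≠ 0 := hb.ne'
  simp only [mul_inv_cancel_left₀ hne, inv_inv, abs_of_pos hb] at h2
  rw [h2, fourier, Complex.real_smul, mul_assoc]
  congr 1
  rw [← integral_const_mul]
  refine integral_congr_ae (Filter.Eventually.of_forall fun x => ?_)
  simp only
  rw [mul_left_comm, ← Complex.exp_add]
  congr 2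
  push_cast
  ring

lemma norm_sq_fourier_dilatedSignal (τ t ω : ℝ) :
    ‖((1 - τ : ℝ) : ℂ) * Complex.exp (((-(t * ω) : ℝ) : ℂ) * Complex.I) *
        fourier f ((1 - τ) * ω)‖ ^ 2 = (1 - τ) ^ 2 * powerSpectrum f ((1 - τ) * ω) := by
  rw [norm_mul, norm_mul, Complex.norm_exp_ofReal_mul_I, Complex.norm_real, Real.norm_eq_abs,
    mul_one, mul_pow, sq_abs, powerSpectrum]

end

section

/-! ### The Gaussian filter -/

/-- The derivative of the Gaussian filter. -/
def gaussianFilterDeriv (L x : ℝ) : ℝ := -(x / L ^ 2) * gaussianFilter L x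

/-- A Gaussian weight, wider than the filter, that dominates all translates of the filter and of
its derivative by bounded amounts. -/
def gaussianWeight (L v : ℝ) : ℝ := Real.exp (-(v ^ 2) / (8 * L ^ 2))

variable {L : ℝ}

lemma gaussianFilter_nonneg (L x : ℝ) : 0 ≤ gaussianFilter L x := by
  unfold gaussianFilter; positivity

lemma continuous_gaussianFilter (L : ℝ) : Continuous (gaussianFilter L) := by
  unfold gaussianFilter; fun_prop

lemma continuous_gaussianFilterDeriv (L : ℝ) : Continuous (gaussianFilterDeriv L) := by
  unfold gaussianFilterDeriv gaussianFilter; fun_prop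

lemma gaussianFilter_eq_gaussianPDFReal (L : ℝ) :
    gaussianFilter L = gaussianPDFReal 0 (L ^ 2).toNNReal := by
  ext x
  simp [gaussianFilter, gaussianPDFReal, sq_nonneg]

lemma hasDerivAt_gaussianFilter (L x : ℝ) :
    HasDerivAt (gaussianFilter L) (gaussianFilterDeriv L x) x := by
  have h : HasDerivAt (fun x : ℝ => -(x ^ 2) / (2 * L ^ 2)) (-(x / L ^ 2)) x := by
    refine (((hasDerivAt_pow 2 x).neg).div_const (2 * L ^ 2)).congr_deriv ?_
    by_cases hL : L = 0
    · simp [hL]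
    · field_simp
      simp
  refine (h.exp.const_mul (√(2 * Real.pi * L ^ 2))⁻¹).congr_deriv ?_
  rw [gaussianFilterDeriv, gaussianFilter]
  ring

lemma toNNReal_sq_ne_zero (hL : 0 < L) : (L ^ 2).toNNReal ≠ 0 := by
  simpa using hL.ne'

lemma integral_gaussianFilter_mul (hL : 0 < L) (g : ℝ → ℝ) :
    ∫ x, gaussianFilter L x * g x = ∫ x, g x ∂gaussianReal 0 (L ^ 2).toNNReal := by
  rw [integral_gaussianReal_eq_integral_smul (toNNReal_sq_ne_zero hL),
    gaussianFilter_eq_gaussianPDFReal]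
  rfl

lemma integrable_gaussianFilter_mul (hL : 0 < L) {g : ℝ → ℝ}
    (hg : Integrable g (gaussianReal 0 (L ^ 2).toNNReal)) :
    Integrable (fun x => gaussianFilter L x * g x) := by
  rw [gaussianReal_of_var_ne_zero _ (toNNReal_sq_ne_zero hL),
    integrable_withDensity_iff_integrable_smul' (measurable_gaussianPDF _ _)
      (Filter.Eventually.of_forall fun x => ENNReal.ofReal_lt_top)] at hg
  refine hg.congr (Filter.Eventually.of_forall fun x => ?_)
  simp [gaussianPDF, gaussianPDFReal_nonneg, gaussianFilter_eq_gaussianPDFReal]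

lemma integrable_gaussianFilter (hL : 0 < L) : Integrable (gaussianFilter L) := by
  simpa using integrable_gaussianFilter_mul hL (g := fun _ => 1) (integrable_const _)

lemma integral_gaussianFilter (hL : 0 < L) : ∫ x, gaussianFilter L x = 1 := by
  simpa using integral_gaussianFilter_mul hL (fun _ => 1)

lemma integrable_gaussianFilter_mul_id (hL : 0 < L) :
    Integrable (fun x => gaussianFilter L x * x) :=
  integrable_gaussianFilter_mul hL
    ((memLp_id_gaussianReal' 1 (by simp)).integrable le_rfl)

lemma integral_gaussianFilter_mul_id (hL : 0 < L) : ∫ x, gaussianFilter L x * x = 0 := by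
  rw [integral_gaussianFilter_mul hL, integral_id_gaussianReal]

lemma integrable_gaussianFilter_mul_sq (hL : 0 < L) :
    Integrable (fun x => gaussianFilter L x * x ^ 2) :=
  integrable_gaussianFilter_mul hL (memLp_id_gaussianReal' 2 (by simp)).integrable_sq

lemma integral_gaussianFilter_mul_sq (hL : 0 < L) :
    ∫ x, gaussianFilter L x * x ^ 2 = L ^ 2 := by
  have h := variance_eq_sub (memLp_id_gaussianReal' (μ := 0) (v := (L ^ 2).toNNReal) 2 (by simp))
  rw [variance_id_gaussianReal] at h
  rw [integral_gaussianFilter_mul hL]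
  have h0 : ∫ x, id x ∂gaussianReal 0 (L ^ 2).toNNReal = 0 := integral_id_gaussianReal
  rw [h0, Real.coe_toNNReal _ (sq_nonneg L)] at h
  simpa using h.symm

/-- The inequality `2 L |x| ≤ L² + x²` reduces the `L¹` norm of the derivative to the moments of
order `0` and `2` of the filter. -/
lemma abs_gaussianFilterDeriv_le (hL : 0 < L) (x : ℝ) :
    |gaussianFilterDeriv L x| ≤
      (2 * L)⁻¹ * gaussianFilter L x + (2 * L ^ 3)⁻¹ * (gaussianFilter L x * x ^ 2) := by
  rw [gaussianFilterDeriv, abs_mul, abs_neg, abs_div, abs_of_nonneg (gaussianFilter_nonneg L x),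
    abs_of_pos (by positivity : (0 : ℝ) < L ^ 2)]
  have : |x| / L ^ 2 ≤ (2 * L)⁻¹ + (2 * L ^ 3)⁻¹ * x ^ 2 := by
    rw [← sub_nonneg]
    have : (2 * L)⁻¹ + (2 * L ^ 3)⁻¹ * x ^ 2 - |x| / L ^ 2 = (2 * L ^ 3)⁻¹ * (L - |x|) ^ 2 := by
      rw [← sq_abs x]
      field_simp
      ring
    rw [this]
    positivity
  calc _ ≤ ((2 * L)⁻¹ + (2 * L ^ 3)⁻¹ * x ^ 2) * gaussianFilter L x :=
        mul_le_mul_of_nonneg_right this (gaussianFilter_nonneg L x)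
    _ = _ := by ring

lemma integrable_gaussianFilterDeriv (hL : 0 < L) : Integrable (gaussianFilterDeriv L) :=
  (((integrable_gaussianFilter hL).const_mul _).add
    ((integrable_gaussianFilter_mul_sq hL).const_mul _)).mono'
    (continuous_gaussianFilterDeriv L).aestronglyMeasurable
    (Filter.Eventually.of_forall fun x => abs_gaussianFilterDeriv_le hL x)

lemma integral_abs_gaussianFilterDeriv_le (hL : 0 < L) :
    ∫ x, |gaussianFilterDeriv L x| ≤ L⁻¹ := by
  refine (integral_mono (integrable_gaussianFilterDeriv hL).abs
    (((integrable_gaussianFilter hL).const_mul _).add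
      ((integrable_gaussianFilter_mul_sq hL).const_mul _))
    fun x => abs_gaussianFilterDeriv_le hL x).trans (le_of_eq ?_)
  simp only [Pi.add_apply]
  rw [integral_add ((integrable_gaussianFilter hL).const_mul _)
    ((integrable_gaussianFilter_mul_sq hL).const_mul _), integral_const_mul, integral_const_mul,
    integral_gaussianFilter hL, integral_gaussianFilter_mul_sq hL]
  field_simp
  norm_num

lemma gaussianWeight_pos (L v : ℝ) : 0 < gaussianWeight L v := Real.exp_pos _

lemma continuous_gaussianWeight (L : ℝ) : Continuous (gaussianWeight L) := by
  unfold gaussianWeight; fun_prop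

lemma integrable_gaussianWeight (hL : 0 < L) : Integrable (gaussianWeight L) := by
  refine (integrable_exp_neg_mul_sq (b := (8 * L ^ 2)⁻¹) (by positivity)).congr
    (Filter.Eventually.of_forall fun x => ?_)
  simp only [gaussianWeight]
  congr 1
  field_simp

/-- This holds because `(u - v)² ≥ v² / 2 - u²`. -/
lemma exp_le_gaussianWeight (hL : 0 < L) {R u : ℝ} (hu : |u| ≤ R) (v : ℝ) :
    Real.exp (-((u - v) ^ 2) / (4 * L ^ 2)) ≤
      Real.exp (R ^ 2 / (4 * L ^ 2)) * gaussianWeight L v := by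
  rw [gaussianWeight, ← Real.exp_add]
  refine Real.exp_le_exp.2 ?_
  have h1 : u ^ 2 ≤ R ^ 2 := sq_le_sq' (by linarith [abs_le.1 hu]) (abs_le.1 hu).2
  have h2 : R ^ 2 / (4 * L ^ 2) + -v ^ 2 / (8 * L ^ 2) - -(u - v) ^ 2 / (4 * L ^ 2) =
      (2 * R ^ 2 - v ^ 2 + 2 * (u - v) ^ 2) / (8 * L ^ 2) := by
    field_simp
    ring
  have h3 : 0 ≤ (2 * R ^ 2 - v ^ 2 + 2 * (u - v) ^ 2) / (8 * L ^ 2) := by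
    apply div_nonneg _ (by positivity)
    nlinarith [sq_nonneg (v - 2 * u)]
  linarith

/-- The constant in the domination of translates of the filter by `gaussianWeight`. -/
def translateConst (L R : ℝ) : ℝ :=
  (1 + L⁻¹) * (√(2 * Real.pi * L ^ 2))⁻¹ * Real.exp (R ^ 2 / (4 * L ^ 2))

lemma gaussianFilter_le_weight (hL : 0 < L) {R u : ℝ} (hu : |u| ≤ R) (v : ℝ) :
    gaussianFilter L (u - v) ≤ translateConst L R * gaussianWeight L v := by
  have h1 : Real.exp (-((u - v) ^ 2) / (2 * L ^ 2)) ≤ Real.exp (-((u - v) ^ 2) / (4 * L ^ 2)) := by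
    refine Real.exp_le_exp.2 ?_
    rw [neg_div, neg_div, neg_le_neg_iff]
    gcongr
    norm_num
  have h2 : 1 ≤ 1 + L⁻¹ := by simp [hL.le]
  rw [gaussianFilter, translateConst]
  calc _ ≤ 1 * ((√(2 * Real.pi * L ^ 2))⁻¹ *
        (Real.exp (R ^ 2 / (4 * L ^ 2)) * gaussianWeight L v)) := by
        rw [one_mul]
        exact mul_le_mul_of_nonneg_left (h1.trans (exp_le_gaussianWeight hL hu v)) (by positivity)
    _ ≤ (1 + L⁻¹) * ((√(2 * Real.pi * L ^ 2))⁻¹ *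
        (Real.exp (R ^ 2 / (4 * L ^ 2)) * gaussianWeight L v)) :=
        mul_le_mul_of_nonneg_right h2 (by have := gaussianWeight_pos L v; positivity)
    _ = _ := by ring

/-- Half of the exponent of the filter absorbs the factor `|u - v|`. -/
lemma abs_gaussianFilterDeriv_le_weight (hL : 0 < L) {R u : ℝ} (hu : |u| ≤ R) (v : ℝ) :
    |gaussianFilterDeriv L (u - v)| ≤ translateConst L R * gaussianWeight L v := by
  have key : |u - v| / L ^ 2 * Real.exp (-((u - v) ^ 2) / (2 * L ^ 2)) ≤
      L⁻¹ * Real.exp (-((u - v) ^ 2) / (4 * L ^ 2)) := by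
    set x := |u - v| / L with hx
    have hxx : (u - v) ^ 2 = (x * L) ^ 2 := by
      rw [hx, div_mul_cancel₀ _ hL.ne', sq_abs]
    have e1 : -((u - v) ^ 2) / (2 * L ^ 2) = -(x ^ 2 / 4) + -(x ^ 2 / 4) := by
      rw [hxx]; field_simp; ring
    have e2 : -((u - v) ^ 2) / (4 * L ^ 2) = -(x ^ 2 / 4) := by
      rw [hxx]; field_simp
    have e3 : |u - v| / L ^ 2 = L⁻¹ * x := by rw [hx]; field_simp
    rw [e1, e2, e3, Real.exp_add, ← mul_assoc, mul_assoc L⁻¹]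
    have h4 : x * Real.exp (-(x ^ 2 / 4)) ≤ 1 := by
      rw [Real.exp_neg, ← div_eq_mul_inv, div_le_one (Real.exp_pos _)]
      nlinarith [Real.add_one_le_exp (x ^ 2 / 4), sq_nonneg (x / 2 - 1)]
    have := mul_le_mul_of_nonneg_right (mul_le_mul_of_nonneg_left h4 (inv_nonneg.2 hL.le))
      (Real.exp_pos (-(x ^ 2 / 4))).le
    simpa using this
  have h2 : L⁻¹ ≤ 1 + L⁻¹ := by simp
  rw [gaussianFilterDeriv, abs_mul, abs_neg, abs_div, abs_of_nonneg (gaussianFilter_nonneg _ _),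
    abs_of_pos (by positivity : (0 : ℝ) < L ^ 2), gaussianFilter, translateConst]
  calc _ = (√(2 * Real.pi * L ^ 2))⁻¹ *
        (|u - v| / L ^ 2 * Real.exp (-((u - v) ^ 2) / (2 * L ^ 2))) := by ring
    _ ≤ (√(2 * Real.pi * L ^ 2))⁻¹ * (L⁻¹ * Real.exp (-((u - v) ^ 2) / (4 * L ^ 2))) := by gcongr
    _ ≤ (√(2 * Real.pi * L ^ 2))⁻¹ *
        ((1 + L⁻¹) * (Real.exp (R ^ 2 / (4 * L ^ 2)) * gaussianWeight L v)) := by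
        gcongr
        exact exp_le_gaussianWeight hL hu v
    _ = _ := by ring

/-! ### Smoothing of data -/

variable {h : ℝ → ℝ}

lemma smooth_apply (L : ℝ) (h : ℝ → ℝ) (u : ℝ) :
    smooth L h u = ∫ v, h v * gaussianFilter L (u - v) := rfl

lemma integrable_mul_of_le_weight (hm : Measurable h)
    (hi : Integrable (fun v => h v * gaussianWeight L v)) {g : ℝ → ℝ} (hg : Measurable g) {A : ℝ}
    (hA : ∀ v, |g v| ≤ A * gaussianWeight L v) :
    Integrable (fun v => h v * g v) ∧ |∫ v, h v * g v| ≤ A * ∫ v, |h v * gaussianWeight L v| := by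
  have hb : ∀ v, ‖h v * g v‖ ≤ A * |h v * gaussianWeight L v| := fun v => by
    rw [Real.norm_eq_abs, abs_mul, abs_mul, abs_of_pos (gaussianWeight_pos L v)]
    calc _ ≤ |h v| * (A * gaussianWeight L v) :=
          mul_le_mul_of_nonneg_left (hA v) (abs_nonneg _)
      _ = _ := by ring
  refine ⟨(hi.abs.const_mul A).mono' (hm.mul hg).aestronglyMeasurable
    (Filter.Eventually.of_forall hb), ?_⟩
  rw [← integral_const_mul, ← Real.norm_eq_abs]
  exact norm_integral_le_of_norm_le (hi.abs.const_mul A) (Filter.Eventually.of_forall hb)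

lemma integrable_mul_gaussianFilter (hL : 0 < L) (hm : Measurable h)
    (hi : Integrable (fun v => h v * gaussianWeight L v)) (u : ℝ) :
    Integrable (fun v => h v * gaussianFilter L (u - v)) :=
  (integrable_mul_of_le_weight hm hi
    ((continuous_gaussianFilter L).measurable.comp (by fun_prop)) (A := translateConst L |u|)
    fun v => (abs_of_nonneg (gaussianFilter_nonneg L _)).trans_le
      (gaussianFilter_le_weight hL le_rfl v)).1

lemma integrable_mul_gaussianFilterDeriv (hL : 0 < L) (hm : Measurable h)
    (hi : Integrable (fun v => h v * gaussianWeight L v)) (u : ℝ) :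
    Integrable (fun v => h v * gaussianFilterDeriv L (u - v)) :=
  (integrable_mul_of_le_weight hm hi
    ((continuous_gaussianFilterDeriv L).measurable.comp (by fun_prop)) (A := translateConst L |u|)
    fun v => abs_gaussianFilterDeriv_le_weight hL le_rfl v).1

lemma abs_smooth_le (hL : 0 < L) (hm : Measurable h)
    (hi : Integrable (fun v => h v * gaussianWeight L v)) {R u : ℝ} (hu : |u| ≤ R) :
    |smooth L h u| ≤ translateConst L R * ∫ v, |h v * gaussianWeight L v| :=
  (integrable_mul_of_le_weight hm hi
    ((continuous_gaussianFilter L).measurable.comp (by fun_prop))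
    fun v => (abs_of_nonneg (gaussianFilter_nonneg L _)).trans_le
      (gaussianFilter_le_weight hL hu v)).2

lemma abs_integral_mul_gaussianFilterDeriv_le (hL : 0 < L) (hm : Measurable h)
    (hi : Integrable (fun v => h v * gaussianWeight L v)) {R u : ℝ} (hu : |u| ≤ R) :
    |∫ v, h v * gaussianFilterDeriv L (u - v)| ≤
      translateConst L R * ∫ v, |h v * gaussianWeight L v| :=
  (integrable_mul_of_le_weight hm hi
    ((continuous_gaussianFilterDeriv L).measurable.comp (by fun_prop))
    fun v => abs_gaussianFilterDeriv_le_weight hL hu v).2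

lemma convolutionExists_gaussianFilter (hL : 0 < L) (hm : Measurable h)
    (hi : Integrable (fun v => h v * gaussianWeight L v)) :
    ConvolutionExists h (gaussianFilter L) (ContinuousLinearMap.mul ℝ ℝ) volume :=
  fun u => integrable_mul_gaussianFilter hL hm hi u

lemma hasDerivAt_smooth (hL : 0 < L) (hm : Measurable h)
    (hi : Integrable (fun v => h v * gaussianWeight L v)) (u : ℝ) :
    HasDerivAt (smooth L h) (∫ v, h v * gaussianFilterDeriv L (u - v)) u := by
  refine (hasDerivAt_integral_of_dominated_loc_of_deriv_le (μ := volume) (x₀ := u)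
    (F := fun u v => h v * gaussianFilter L (u - v))
    (F' := fun u v => h v * gaussianFilterDeriv L (u - v))
    (bound := fun v => translateConst L (|u| + 1) * |h v * gaussianWeight L v|)
    (Metric.ball_mem_nhds u one_pos)
    (Filter.Eventually.of_forall fun w =>
      (integrable_mul_gaussianFilter hL hm hi w).aestronglyMeasurable)
    (integrable_mul_gaussianFilter hL hm hi u)
    (integrable_mul_gaussianFilterDeriv hL hm hi u).aestronglyMeasurable
    (Filter.Eventually.of_forall fun v w hw => ?_)
    (hi.abs.const_mul _)
    (Filter.Eventually.of_forall fun v w _ => ?_)).2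
  · have hw' : |w| ≤ |u| + 1 := by
      have h1 : |w - u| < 1 := by simpa [Real.dist_eq] using hw
      have h2 := abs_sub_abs_le_abs_sub w u
      linarith
    rw [Real.norm_eq_abs, abs_mul, abs_mul, abs_of_pos (gaussianWeight_pos L v)]
    calc _ ≤ |h v| * (translateConst L (|u| + 1) * gaussianWeight L v) :=
          mul_le_mul_of_nonneg_left (abs_gaussianFilterDeriv_le_weight hL hw' v) (abs_nonneg _)
      _ = _ := by ring
  · exact ((hasDerivAt_gaussianFilter L (w - v)).comp_sub_const w v).const_mul (h v)

/-! ### Bias of the smoothing -/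

lemma abs_taylor_le {K : ℝ} {q₀ q₁ q₂ : ℝ → ℝ} (h0 : ∀ x, HasDerivAt q₀ (q₁ x) x)
    (h1 : ∀ x, HasDerivAt q₁ (q₂ x) x) (hK : ∀ x, |q₂ x| ≤ K) (u v : ℝ) :
    |q₀ (u - v) - q₀ u + v * q₁ u| ≤ K * v ^ 2 := by
  have hlip : ∀ x y, |q₁ y - q₁ x| ≤ K * |y - x| := fun x y =>
    convex_univ.norm_image_sub_le_of_norm_hasDerivWithin_le
      (fun z _ => (h1 z).hasDerivWithinAt) (fun z _ => hK z) (mem_univ x) (mem_univ y)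
  have hd : ∀ s, HasDerivAt (fun s => q₀ (u - s) + s * q₁ u) (-q₁ (u - s) + q₁ u) s := fun s =>
    (((h0 (u - s)).comp_const_sub u s).add ((hasDerivAt_id s).mul_const (q₁ u))).congr_deriv
      (by simp)
  have hK0 : 0 ≤ K := (abs_nonneg _).trans (hK 0)
  have := (convex_uIcc (0 : ℝ) v).norm_image_sub_le_of_norm_hasDerivWithin_le
    (C := K * |v|) (fun s _ => (hd s).hasDerivWithinAt) (fun s hs => ?_)
    left_mem_uIcc right_mem_uIcc
  · simp only [Real.norm_eq_abs, sub_zero, zero_mul, add_zero] at this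
    rw [mul_assoc, abs_mul_abs_self, ← sq] at this
    convert this using 2
    ring
  · have h2 := hlip (u - s) u
    have h3 : |s| ≤ |v| := by simpa using abs_sub_left_of_mem_uIcc hs
    rw [Real.norm_eq_abs, neg_add_eq_sub]
    refine h2.trans ?_
    rw [sub_sub_cancel]
    gcongr

/-- A symmetric filter of variance `L²` changes a function with bounded second derivative by
`O(L²)`. -/
lemma abs_integral_gaussianFilter_sub_le (hL : 0 < L) {K : ℝ} {q₀ q₁ q₂ : ℝ → ℝ}
    (h0 : ∀ x, HasDerivAt q₀ (q₁ x) x) (h1 : ∀ x, HasDerivAt q₁ (q₂ x) x)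
    (hK0 : ∀ x, |q₀ x| ≤ K) (hK : ∀ x, |q₂ x| ≤ K) (u : ℝ) :
    |(∫ v, gaussianFilter L v * q₀ (u - v)) - q₀ u| ≤ K * L ^ 2 := by
  have hc : Continuous q₀ := continuous_iff_continuousAt.2 fun x => (h0 x).continuousAt
  have hi1 : Integrable (fun v => gaussianFilter L v * q₀ (u - v)) :=
    (integrable_gaussianFilter hL).mul_bdd (c := K)
      (by fun_prop : Continuous fun v => q₀ (u - v)).aestronglyMeasurable
      (Filter.Eventually.of_forall fun v => hK0 _)
  have hi2 := (integrable_gaussianFilter hL).mul_const (q₀ u)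
  have hi3 := (integrable_gaussianFilter_mul_id hL).mul_const (q₁ u)
  have e : (∫ v, gaussianFilter L v * q₀ (u - v)) - q₀ u =
      ∫ v, gaussianFilter L v * (q₀ (u - v) - q₀ u + v * q₁ u) := by
    have : ∀ v, gaussianFilter L v * (q₀ (u - v) - q₀ u + v * q₁ u) =
        gaussianFilter L v * q₀ (u - v) - gaussianFilter L v * q₀ u +
          gaussianFilter L v * v * q₁ u := fun v => by ring
    simp only [this]
    rw [integral_add (f := fun v => gaussianFilter L v * q₀ (u - v) - gaussianFilter L v * q₀ u)
      (hi1.sub hi2) hi3, integral_sub hi1 hi2, integral_mul_const,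
      integral_mul_const, integral_gaussianFilter hL, integral_gaussianFilter_mul_id hL]
    ring
  rw [e, ← integral_gaussianFilter_mul_sq hL, ← integral_const_mul, ← Real.norm_eq_abs]
  refine norm_integral_le_of_norm_le ((integrable_gaussianFilter_mul_sq hL).const_mul K)
    (Filter.Eventually.of_forall fun v => ?_)
  rw [Real.norm_eq_abs, abs_mul, abs_of_nonneg (gaussianFilter_nonneg L v)]
  calc _ ≤ gaussianFilter L v * (K * v ^ 2) :=
        mul_le_mul_of_nonneg_left (abs_taylor_le h0 h1 hK u v) (gaussianFilter_nonneg L v)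
    _ = _ := by ring

lemma smooth_eq_integral_sub (L : ℝ) (h : ℝ → ℝ) (u : ℝ) :
    smooth L h u = ∫ v, gaussianFilter L v * h (u - v) := by
  rw [smooth_apply, ← integral_sub_left_eq_self _ volume u]
  exact integral_congr_ae (Filter.Eventually.of_forall fun v => by simp [mul_comm])

lemma BoundedDerivs.continuous₀ {K : ℝ} {q₀ q₁ q₂ q₃ : ℝ → ℝ} (hq : BoundedDerivs K q₀ q₁ q₂ q₃) :
    Continuous q₀ := continuous_iff_continuousAt.2 fun x => (hq.deriv₀ x).continuousAt

lemma BoundedDerivs.continuous₁ {K : ℝ} {q₀ q₁ q₂ q₃ : ℝ → ℝ} (hq : BoundedDerivs K q₀ q₁ q₂ q₃) :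
    Continuous q₁ := continuous_iff_continuousAt.2 fun x => (hq.deriv₁ x).continuousAt

lemma BoundedDerivs.integrable_mul_gaussianWeight {K : ℝ} {q₀ q₁ q₂ q₃ : ℝ → ℝ}
    (hq : BoundedDerivs K q₀ q₁ q₂ q₃) (hL : 0 < L) :
    Integrable (fun v => q₀ v * gaussianWeight L v) :=
  (integrable_gaussianWeight hL).bdd_mul (c := K) hq.continuous₀.aestronglyMeasurable
    (Filter.Eventually.of_forall hq.bound₀)

lemma BoundedDerivs.abs_smooth_sub_le {K : ℝ} {q₀ q₁ q₂ q₃ : ℝ → ℝ}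
    (hq : BoundedDerivs K q₀ q₁ q₂ q₃) (hL : 0 < L) (u : ℝ) :
    |smooth L q₀ u - q₀ u| ≤ K * L ^ 2 := by
  rw [smooth_eq_integral_sub]
  exact abs_integral_gaussianFilter_sub_le hL hq.deriv₀ hq.deriv₁ hq.bound₀ hq.bound₂ u

lemma BoundedDerivs.abs_deriv_smooth_sub_le {K : ℝ} {q₀ q₁ q₂ q₃ : ℝ → ℝ}
    (hq : BoundedDerivs K q₀ q₁ q₂ q₃) (hL : 0 < L) (u : ℝ) :
    |deriv (smooth L q₀) u - q₁ u| ≤ K * L ^ 2 := by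
  have hc0 := hq.continuous₀
  have hc1 := hq.continuous₁
  have hd : HasDerivAt (smooth L q₀) (∫ v, gaussianFilter L v * q₁ (u - v)) u := by
    rw [funext (smooth_eq_integral_sub L q₀)]
    refine (hasDerivAt_integral_of_dominated_loc_of_deriv_le (μ := volume) (x₀ := u)
      (F := fun u v => gaussianFilter L v * q₀ (u - v))
      (F' := fun u v => gaussianFilter L v * q₁ (u - v))
      (bound := fun v => gaussianFilter L v * K) Filter.univ_mem
      (Filter.Eventually.of_forall fun w => ?_) ?_ ?_
      (Filter.Eventually.of_forall fun v w _ => ?_)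
      ((integrable_gaussianFilter hL).mul_const K)
      (Filter.Eventually.of_forall fun v w _ => ?_)).2
    · exact ((continuous_gaussianFilter L).mul (by fun_prop)).aestronglyMeasurable
    · exact (integrable_gaussianFilter hL).mul_bdd (c := K)
        (by fun_prop : Continuous fun v => q₀ (u - v)).aestronglyMeasurable
        (Filter.Eventually.of_forall fun v => hq.bound₀ _)
    · exact ((continuous_gaussianFilter L).mul (by fun_prop)).aestronglyMeasurable
    · rw [Real.norm_eq_abs, abs_mul, abs_of_nonneg (gaussianFilter_nonneg L v)]
      exact mul_le_mul_of_nonneg_left (hq.bound₁ _) (gaussianFilter_nonneg L v)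
    · exact ((hq.deriv₀ (w - v)).comp_sub_const w v).const_mul _
  rw [hd.deriv]
  exact abs_integral_gaussianFilter_sub_le hL hq.deriv₁ hq.deriv₂ hq.bound₁ hq.bound₃ u

end

section

/-! ### Second moments of weighted averages -/

lemma sq_lintegral_mul_le {α : Type*} [MeasurableSpace α] (μ : Measure α) {w g : α → ℝ≥0∞}
    (hw : AEMeasurable w μ) (hg : AEMeasurable g μ) :
    (∫⁻ v, w v * g v ∂μ) ^ 2 ≤ (∫⁻ v, w v ∂μ) * ∫⁻ v, w v * g v ^ 2 ∂μ := by
  have h := ENNReal.lintegral_mul_le_Lp_mul_Lq μ Real.HolderConjugate.two_two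
    (hw.pow_const (1 / 2 : ℝ)) ((hw.pow_const (1 / 2 : ℝ)).mul hg)
  have hs : ∀ x : ℝ≥0∞, (x ^ (1 / 2 : ℝ)) ^ (2 : ℝ) = x := fun x => by
    rw [← ENNReal.rpow_mul]; norm_num
  have hp : ∀ x : ℝ≥0∞, x ^ (1 / 2 : ℝ) * x ^ (1 / 2 : ℝ) = x := fun x => by
    rw [← sq, ← ENNReal.rpow_natCast]; exact hs x
  have h1 : ∀ v, ((fun x => w x ^ (1 / 2 : ℝ)) * ((fun x => w x ^ (1 / 2 : ℝ)) * g)) v =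
      w v * g v := fun v => by
    simp only [Pi.mul_apply]
    rw [← mul_assoc, hp]
  have h2 : ∀ v, ((fun x => w x ^ (1 / 2 : ℝ)) * g) v ^ (2 : ℝ) = w v * g v ^ 2 := fun v => by
    simp only [Pi.mul_apply]
    rw [ENNReal.mul_rpow_of_nonneg _ _ (by norm_num), hs, ENNReal.rpow_two]
  simp only [h1, h2, hs] at h
  refine (pow_le_pow_left' h 2).trans (le_of_eq ?_)
  rw [mul_pow]
  simp only [← ENNReal.rpow_natCast, Nat.cast_ofNat, hs]

/-- If `X(·, v)` has second moment at most `B` for every `v`, a weighted sum of the `X(·, v)` has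
second moment at most `(∫ w)² B`. -/
lemma lintegral_sq_lintegral_mul_le {S α : Type*} [MeasurableSpace S] [MeasurableSpace α]
    (P : Measure S) [SFinite P] (μ : Measure α) [SFinite μ] {w : α → ℝ≥0∞} (hw : Measurable w)
    {X : S → α → ℝ≥0∞} (hX : Measurable (Function.uncurry X)) {B : ℝ≥0∞}
    (hB : ∀ v, w v ≠ 0 → ∫⁻ s, X s v ^ 2 ∂P ≤ B) :
    ∫⁻ s, (∫⁻ v, w v * X s v ∂μ) ^ 2 ∂P ≤ (∫⁻ v, w v ∂μ) ^ 2 * B := by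
  have hXs : ∀ s, Measurable (X s) := fun s => hX.comp measurable_prodMk_left
  have hXv : ∀ v, Measurable fun s => X s v := fun v => hX.comp measurable_prodMk_right
  have hm : Measurable (Function.uncurry fun s v => w v * X s v ^ 2) :=
    (hw.comp measurable_snd).mul (hX.pow_const 2)
  calc _ ≤ ∫⁻ s, (∫⁻ v, w v ∂μ) * ∫⁻ v, w v * X s v ^ 2 ∂μ ∂P :=
        lintegral_mono fun s => sq_lintegral_mul_le μ hw.aemeasurable (hXs s).aemeasurable
    _ = (∫⁻ v, w v ∂μ) * ∫⁻ v, ∫⁻ s, w v * X s v ^ 2 ∂P ∂μ := by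
        rw [lintegral_const_mul _ (Measurable.lintegral_prod_right hm),
          lintegral_lintegral_swap hm.aemeasurable]
    _ ≤ (∫⁻ v, w v ∂μ) * ∫⁻ v, w v * B ∂μ := by
        gcongr with v
        rw [lintegral_const_mul _ ((hXv v).pow_const 2)]
        by_cases h0 : w v = 0
        · simp [h0]
        · gcongr
          exact hB v h0
    _ = _ := by
        rw [lintegral_mul_const _ hw]
        ring

/-! ### The Neumann series -/

lemma iterate_dilation (C : ℝ) (h : ℝ → ℝ) (i : ℕ) (ω : ℝ) :
    ((dilation C)^[i] h) ω = (C ^ 3) ^ i * h (C ^ i * ω) := by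
  induction i generalizing ω with
  | zero => simp
  | succ i ih =>
    rw [Function.iterate_succ_apply', dilation, ih, ← mul_assoc, ← mul_assoc, ← pow_succ',
      ← pow_succ]

section Constants

variable {η : ℝ}

lemma sqrt_three_mul_pos (h0 : 0 < η) : 0 < √3 * η := by positivity

lemma sqrt_three_mul_le (h1 : η ^ 2 ≤ 1 / 12) : √3 * η ≤ 1 / 2 := by
  refine abs_le_of_sq_le_sq' ?_ (by norm_num) |>.2
  rw [mul_pow, Real.sq_sqrt (by norm_num)]
  linarith

lemma C0_pos (h0 : 0 < η) (h1 : η ^ 2 ≤ 1 / 12) : 0 < C0 η := by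
  have h2 := sqrt_three_mul_le h1
  have h3 := sqrt_three_mul_pos h0
  exact div_pos (by linarith) (by linarith)

lemma C0_lt_one (h0 : 0 < η) : C0 η < 1 := by
  have h3 := sqrt_three_mul_pos h0
  rw [C0, div_lt_one (by linarith)]
  linarith

lemma C1_pos (h0 : 0 < η) : 0 < C1 η := by
  unfold C1; positivity

lemma C2_pos (h0 : 0 < η) : 0 < C2 η := by
  unfold C2; positivity

lemma C2_le_one (h0 : 0 < η) : C2 η ≤ 1 := by
  have h3 := sqrt_three_mul_pos h0
  rw [C2, div_le_one (by linarith)]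
  linarith

/-- The weights of the series representing the inversion. -/
def seriesWeight (η : ℝ) (i : ℕ) : ℝ := C1 η * C2 η ^ 3 * (C0 η ^ 3) ^ i

/-- The frequencies occurring in the series representing the inversion. -/
def seriesFreq (η ω : ℝ) (i : ℕ) : ℝ := C2 η * (C0 η ^ i * ω)

lemma seriesWeight_pos (h0 : 0 < η) (h1 : η ^ 2 ≤ 1 / 12) (i : ℕ) : 0 < seriesWeight η i := by
  have := C0_pos h0 h1
  have := C1_pos h0
  have := C2_pos h0
  unfold seriesWeight; positivity

lemma abs_seriesFreq_le (h0 : 0 < η) (h1 : η ^ 2 ≤ 1 / 12) (ω : ℝ) (i : ℕ) :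
    |seriesFreq η ω i| ≤ |ω| := by
  have h2 := C0_pos h0 h1
  have h3 := C2_pos h0
  rw [seriesFreq, abs_mul, abs_mul, abs_of_pos h3, abs_of_pos (pow_pos h2 i), ← mul_assoc]
  exact mul_le_of_le_one_left (abs_nonneg _)
    (mul_le_one₀ (C2_le_one h0) (pow_pos h2 i).le (pow_le_one₀ h2.le (C0_lt_one h0).le))

lemma summable_seriesWeight (h0 : 0 < η) (h1 : η ^ 2 ≤ 1 / 12) : Summable (seriesWeight η) :=
  (summable_geometric_of_lt_one (by have := C0_pos h0 h1; positivity)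
    (pow_lt_one₀ (C0_pos h0 h1).le (C0_lt_one h0) (by norm_num))).mul_left _

/-- The factor `C₁ ~ η` compensates the norm `~ 1/η` of the Neumann series, uniformly in `η`. -/
lemma tsum_seriesWeight_le (h0 : 0 < η) (h1 : η ^ 2 ≤ 1 / 12) : ∑' i, seriesWeight η i ≤ 3 / 2 := by
  have hC0 := C0_pos h0 h1
  have hC0' := C0_lt_one h0
  have h2 := sqrt_three_mul_le h1
  have h3 := sqrt_three_mul_pos h0
  have h4 : C0 η ^ 3 ≤ C0 η := pow_le_of_le_one hC0.le hC0'.le (by norm_num)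
  have h5 : C1 η * (1 - C0 η)⁻¹ = 1 + √3 * η := by
    have : 1 - C0 η = C1 η / (1 + √3 * η) := by
      rw [C0, C1]; field_simp; ring
    rw [this, inv_div, mul_div_cancel₀ _ (C1_pos h0).ne']
  simp only [seriesWeight]
  rw [tsum_mul_left, tsum_geometric_of_lt_one (by positivity) (by linarith)]
  calc C1 η * C2 η ^ 3 * (1 - C0 η ^ 3)⁻¹ ≤ C1 η * 1 * (1 - C0 η)⁻¹ := by
        have := C1_pos h0
        have := C2_pos h0
        have : C2 η ^ 3 ≤ 1 := pow_le_one₀ this.le (C2_le_one h0)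
        have : 0 < 1 - C0 η := by linarith
        have : 0 ≤ (1 - C0 η ^ 3)⁻¹ := inv_nonneg.2 (by linarith)
        gcongr
    _ ≤ 3 / 2 := by rw [mul_one, h5]; linarith

/-- The mean of `3 q(u) + u q'(u)` where `q(u) = x² p(x u)` and `x` is uniform in
`[1 - √3 η, 1 + √3 η]`. -/
def meanUnbiasData (η : ℝ) (p : ℝ → ℝ) (u : ℝ) : ℝ :=
  ((1 + √3 * η) ^ 3 * p ((1 + √3 * η) * u) - (1 - √3 * η) ^ 3 * p ((1 - √3 * η) * u)) / C1 η

/-- `C₁ L_{C₂}` applied to the averaged data is `(I - L_{C₀}) p`. -/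
lemma C1_mul_dilation_meanUnbiasData (h0 : 0 < η) (p : ℝ → ℝ) (ω : ℝ) :
    C1 η * (C2 η ^ 3 * meanUnbiasData η p (C2 η * ω)) = p ω - C0 η ^ 3 * p (C0 η * ω) := by
  have h3 := sqrt_three_mul_pos h0
  have h4 : (1 + √3 * η) * C2 η = 1 := by rw [C2]; field_simp
  have h5 : (1 - √3 * η) * C2 η = C0 η := by rw [C2, C0]; field_simp
  have h6 : (C2 η) ^ 3 * (1 + √3 * η) ^ 3 = 1 := by rw [← mul_pow, mul_comm, h4, one_pow]
  have h7 : (C2 η) ^ 3 * (1 - √3 * η) ^ 3 = C0 η ^ 3 := by rw [← mul_pow, mul_comm (C2 η), h5]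
  rw [meanUnbiasData, ← mul_assoc (1 + √3 * η), ← mul_assoc (1 - √3 * η), h4, h5, one_mul,
    mul_left_comm, mul_div_cancel₀ _ (C1_pos h0).ne', mul_sub, ← mul_assoc, ← mul_assoc, h6, h7,
    one_mul]

lemma hasSum_meanUnbiasData (h0 : 0 < η) (h1 : η ^ 2 ≤ 1 / 12) {p : ℝ → ℝ} {K : ℝ}
    (hp : ∀ x, |p x| ≤ K) (ω : ℝ) :
    HasSum (fun i => seriesWeight η i * meanUnbiasData η p (seriesFreq η ω i)) (p ω) := by
  have hC0 := C0_pos h0 h1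
  have hC0' : C0 η ^ 3 < 1 := pow_lt_one₀ hC0.le (C0_lt_one h0) (by norm_num)
  set x : ℕ → ℝ := fun i => (C0 η ^ 3) ^ i * p (C0 η ^ i * ω) with hx
  have hsum : Summable x := by
    refine Summable.of_norm_bounded (g := fun i => (C0 η ^ 3) ^ i * K)
      ((summable_geometric_of_lt_one (by positivity) hC0').mul_right K) fun i => ?_
    rw [Real.norm_eq_abs, abs_mul, abs_of_pos (by positivity)]
    exact mul_le_mul_of_nonneg_left (hp _) (by positivity)
  have h := hsum.hasSum.sub ((summable_nat_add_iff 1).2 hsum).hasSum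
  have e : ∑' i, x i - ∑' i, x (i + 1) = p ω := by
    rw [hsum.tsum_eq_zero_add]; simp [hx]
  rw [e] at h
  refine h.congr_fun ?_
  intro i
  have := C1_mul_dilation_meanUnbiasData h0 p (C0 η ^ i * ω)
  simp only [seriesWeight, seriesFreq, hx]
  calc _ = (C0 η ^ 3) ^ i * (C1 η * (C2 η ^ 3 * meanUnbiasData η p (C2 η * (C0 η ^ i * ω)))) := by
        ring
    _ = _ := by
        rw [this, pow_succ (C0 η ^ 3), pow_succ' (C0 η) i, mul_assoc (C0 η)]
        ring

variable {L : ℝ} {h : ℝ → ℝ}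

/-- The data `3 k(u) + u k'(u)` for the smoothed data `k = h * φ_L`. -/
def smoothedData (L : ℝ) (h : ℝ → ℝ) (u : ℝ) : ℝ :=
  3 * smooth L h u + u * deriv (smooth L h) u

lemma iterate_dilation_unbiasedData (η L : ℝ) (h : ℝ → ℝ) (i : ℕ) (ω : ℝ) :
    ((dilation (C0 η))^[i] (unbiasedData η L h)) ω =
      seriesWeight η i * smoothedData L h (seriesFreq η ω i) := by
  rw [iterate_dilation]
  simp only [unbiasedData, dilation, seriesWeight, seriesFreq, smoothedData]
  ring

lemma summable_unbiasedData (hL : 0 < L) (h0 : 0 < η) (h1 : η ^ 2 ≤ 1 / 12) (hm : Measurable h)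
    (hi : Integrable (fun v => h v * gaussianWeight L v)) (ω : ℝ) :
    Summable fun i => seriesWeight η i * smoothedData L h (seriesFreq η ω i) := by
  set B := translateConst L |ω| * ∫ v, |h v * gaussianWeight L v|
  refine Summable.of_norm_bounded (g := fun i => seriesWeight η i * (3 * B + |ω| * B))
    ((summable_seriesWeight h0 h1).mul_right _) fun i => ?_
  have hu := abs_seriesFreq_le h0 h1 ω i
  set u := seriesFreq η ω i
  have b1 : |smooth L h u| ≤ B := abs_smooth_le hL hm hi hu
  have b2 : |deriv (smooth L h) u| ≤ B := by
    rw [(hasDerivAt_smooth hL hm hi u).deriv]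
    exact abs_integral_mul_gaussianFilterDeriv_le hL hm hi hu
  rw [Real.norm_eq_abs, abs_mul, abs_of_pos (seriesWeight_pos h0 h1 i)]
  refine mul_le_mul_of_nonneg_left ?_ (seriesWeight_pos h0 h1 i).le
  refine (abs_add_le _ _).trans ?_
  rw [abs_mul, abs_mul, abs_of_pos (by norm_num : (0 : ℝ) < 3)]
  gcongr

lemma inversionWellDefined (hL : 0 < L) (h0 : 0 < η) (h1 : η ^ 2 ≤ 1 / 12) (hm : Measurable h)
    (hi : Integrable (fun v => h v * gaussianWeight L v)) : InversionWellDefined η L h where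
  convolutionExists := convolutionExists_gaussianFilter hL hm hi
  differentiable := fun u => (hasDerivAt_smooth hL hm hi u).differentiableAt
  summable := fun ω => by
    simp only [iterate_dilation_unbiasedData]
    exact summable_unbiasedData hL h0 h1 hm hi ω

/-- The error of the inversion, as a series in the error of the smoothed data. -/
lemma hasSum_sub_inversionUnbias (hL : 0 < L) (h0 : 0 < η) (h1 : η ^ 2 ≤ 1 / 12)
    (hm : Measurable h) (hi : Integrable (fun v => h v * gaussianWeight L v)) {p : ℝ → ℝ} {K : ℝ}
    (hp : ∀ x, |p x| ≤ K) (ω : ℝ) :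
    HasSum (fun i => seriesWeight η i * (meanUnbiasData η p (seriesFreq η ω i) -
      smoothedData L h (seriesFreq η ω i))) (p ω - inversionUnbias η L h ω) := by
  have h2 := (summable_unbiasedData hL h0 h1 hm hi ω).hasSum
  have h3 : inversionUnbias η L h ω =
      ∑' i, seriesWeight η i * smoothedData L h (seriesFreq η ω i) := by
    simp only [inversionUnbias, oneSubDilationInv, iterate_dilation_unbiasedData]
  rw [h3]
  simpa only [mul_sub] using (hasSum_meanUnbiasData h0 h1 hp ω).sub h2

end Constants

end

section

variable {S : Type*} [MeasurableSpace S] {P : Measure S} {M : ℕ}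

/-! ### Averages of uncorrelated variables -/

lemma lintegral_enorm_sq_eq_ofReal {X : S → ℝ} (hX : MemLp X 2 P) :
    ∫⁻ s, ‖X s‖ₑ ^ 2 ∂P = ENNReal.ofReal (∫ s, X s ^ 2 ∂P) := by
  rw [ofReal_integral_eq_lintegral_ofReal hX.integrable_sq
    (Filter.Eventually.of_forall fun s => sq_nonneg _)]
  refine lintegral_congr fun s => ?_
  rw [← sq_abs, ENNReal.ofReal_pow (abs_nonneg _), ← Real.enorm_eq_ofReal_abs]

lemma lintegral_enorm_sq_average_le (hM : 0 < M) {Z : Fin M → S → ℝ} (hZ : ∀ j, MemLp (Z j) 2 P)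
    (h0 : ∀ i j, i ≠ j → ∫ s, Z i s * Z j s ∂P = 0) {B : ℝ} (hB : ∀ j, ∫ s, Z j s ^ 2 ∂P ≤ B) :
    ∫⁻ s, ‖(1 / (M : ℝ)) * ∑ j, Z j s‖ₑ ^ 2 ∂P ≤ ENNReal.ofReal (B / M) := by
  have hM' : (0 : ℝ) < M := by exact_mod_cast hM
  have hsum : MemLp (fun s => (1 / (M : ℝ)) * ∑ j, Z j s) 2 P :=
    (memLp_finsetSum Finset.univ fun j _ => hZ j).const_mul _
  rw [lintegral_enorm_sq_eq_ofReal hsum]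
  refine ENNReal.ofReal_le_ofReal ?_
  have e : ∀ s, ((1 / (M : ℝ)) * ∑ j, Z j s) ^ 2 =
      (1 / (M : ℝ)) ^ 2 * ∑ i, ∑ j, Z i s * Z j s := fun s => by
    rw [mul_pow, sq (∑ j, Z j s), Finset.sum_mul_sum]
  have hij : ∀ i j, Integrable (fun s => Z i s * Z j s) P := fun i j =>
    (hZ i).integrable_mul (hZ j)
  simp only [e]
  rw [integral_const_mul, integral_finsetSum _ fun i _ => integrable_finsetSum _ fun j _ => hij i j]
  have e2 : ∀ i, ∫ s, ∑ j, Z i s * Z j s ∂P = ∫ s, Z i s ^ 2 ∂P := fun i => by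
    rw [integral_finsetSum _ fun j _ => hij i j, Finset.sum_eq_single i]
    · simp only [sq]
    · exact fun j _ hj => h0 i j hj.symm
    · simp
  simp only [e2]
  calc _ ≤ (1 / (M : ℝ)) ^ 2 * ∑ _i : Fin M, B := by
        gcongr with i
        exact hB i
    _ = B / M := by
        simp
        field_simp

/-! ### Random dilations of the power spectrum -/

/-- For `q(u) = x² p₀(x u)`, the value `3 q(u) + u q'(u)`; it is the derivative of
`x ↦ x³ p₀(x u)`. -/
def dilatedData (p₀ p₁ : ℝ → ℝ) (u x : ℝ) : ℝ := 3 * (x ^ 2 * p₀ (x * u)) + u * (x ^ 3 * p₁ (x * u))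

section Dilations

variable {K : ℝ} {p₀ p₁ p₂ p₃ : ℝ → ℝ}

lemma BoundedDerivs.nonneg (hp : BoundedDerivs K p₀ p₁ p₂ p₃) : 0 ≤ K :=
  (abs_nonneg _).trans (hp.bound₀ 0)

lemma hasDerivAt_cube_mul (hp : BoundedDerivs K p₀ p₁ p₂ p₃) (u x : ℝ) :
    HasDerivAt (fun x => x ^ 3 * p₀ (x * u)) (dilatedData p₀ p₁ u x) x := by
  have h1 : HasDerivAt (fun x => p₀ (x * u)) (p₁ (x * u) * u) x :=
    (hp.deriv₀ (x * u)).comp x (hasDerivAt_mul_const u)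
  refine ((hasDerivAt_pow 3 x).mul h1).congr_deriv ?_
  simp only [dilatedData]
  push_cast
  ring

lemma continuous_dilatedData (hp : BoundedDerivs K p₀ p₁ p₂ p₃) (u : ℝ) :
    Continuous (dilatedData p₀ p₁ u) := by
  have := hp.continuous₀
  have := hp.continuous₁
  unfold dilatedData
  fun_prop

lemma hasDerivAt_dilatedData (hp : BoundedDerivs K p₀ p₁ p₂ p₃) (u x : ℝ) :
    HasDerivAt (dilatedData p₀ p₁ u)
      (6 * x * p₀ (x * u) + 6 * x ^ 2 * u * p₁ (x * u) + x ^ 3 * u ^ 2 * p₂ (x * u)) x := by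
  have h1 : HasDerivAt (fun x => p₀ (x * u)) (p₁ (x * u) * u) x :=
    (hp.deriv₀ (x * u)).comp x (hasDerivAt_mul_const u)
  have h2 : HasDerivAt (fun x => p₁ (x * u)) (p₂ (x * u) * u) x :=
    (hp.deriv₁ (x * u)).comp x (hasDerivAt_mul_const u)
  refine ((((hasDerivAt_pow 2 x).mul h1).const_mul 3).add
    (((hasDerivAt_pow 3 x).mul h2).const_mul u)).congr_deriv ?_
  push_cast
  ring

/-- The Lipschitz constant of `dilatedData p₀ p₁ u` on dilation factors of size at most `3 / 2`. -/
def dilatedDataConst (K R : ℝ) : ℝ := K * (9 + 14 * R + 4 * R ^ 2)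

lemma abs_dilatedData_sub_le (hp : BoundedDerivs K p₀ p₁ p₂ p₃) {R u : ℝ} (hu : |u| ≤ R) {x : ℝ}
    (hx : x ∈ Icc (1 / 2 : ℝ) (3 / 2)) :
    |dilatedData p₀ p₁ u x - dilatedData p₀ p₁ u 1| ≤ dilatedDataConst K R * |x - 1| := by
  refine (convex_Icc (1 / 2 : ℝ) (3 / 2)).norm_image_sub_le_of_norm_hasDerivWithin_le
    (fun y _ => (hasDerivAt_dilatedData hp u y).hasDerivWithinAt) (fun y hy => ?_)
    ⟨by norm_num, by norm_num⟩ hx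
  have hR : 0 ≤ R := (abs_nonneg u).trans hu
  have hK := hp.nonneg
  have hy0 : 0 ≤ y := by linarith [hy.1]
  have hy1 := hy.2
  have b0 := hp.bound₀ (y * u)
  have b1 := hp.bound₁ (y * u)
  have b2 := hp.bound₂ (y * u)
  have hu2 : u ^ 2 ≤ R ^ 2 := by rw [← sq_abs]; gcongr
  rw [Real.norm_eq_abs]
  refine (abs_add_three _ _ _).trans ?_
  simp only [abs_mul, abs_pow, abs_of_nonneg hy0, sq_abs, Nat.abs_ofNat]
  calc _ ≤ 6 * (3 / 2) * K + 6 * (3 / 2) ^ 2 * R * K + (3 / 2) ^ 3 * R ^ 2 * K := by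
        gcongr
    _ ≤ _ := by
        rw [dilatedDataConst]
        nlinarith [mul_nonneg hK hR, mul_nonneg hK (sq_nonneg R)]

lemma integral_comp_uniform {a : ℝ} (ha : 0 < a) {τ : S → ℝ} (hτ : Measurable τ)
    (hu : pdf.IsUniform τ (Icc (-a) a) P volume) {g : ℝ → ℝ} (hg : Continuous g) :
    ∫ s, g (τ s) ∂P = (2 * a)⁻¹ * ∫ x in (-a)..a, g x := by
  rw [← integral_map hτ.aemeasurable hg.aestronglyMeasurable, hu, ProbabilityTheory.cond,
    integral_smul_measure, Real.volume_Icc, intervalIntegral.integral_of_le (by linarith),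
    integral_Icc_eq_integral_Ioc, smul_eq_mul, ENNReal.toReal_inv,
    ENNReal.toReal_ofReal (by linarith)]
  ring

lemma ae_mem_Icc_of_uniform {a : ℝ} {τ : S → ℝ} (hτ : Measurable τ)
    (hu : pdf.IsUniform τ (Icc (-a) a) P volume) : ∀ᵐ s ∂P, τ s ∈ Icc (-a) a := by
  have h : ∀ᵐ x ∂(P.map τ), x ∈ Icc (-a) a := by
    rw [hu, ProbabilityTheory.cond]
    exact Measure.ae_smul_measure (ae_restrict_mem measurableSet_Icc) _
  exact ae_of_ae_map hτ.aemeasurable h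

lemma integral_dilatedData {η : ℝ} (h0 : 0 < η) (hp : BoundedDerivs K p₀ p₁ p₂ p₃) {τ : S → ℝ}
    (hτ : Measurable τ) (hu : pdf.IsUniform τ (Icc (-(√3 * η)) (√3 * η)) P volume) (u : ℝ) :
    ∫ s, dilatedData p₀ p₁ u (1 - τ s) ∂P = meanUnbiasData η p₀ u := by
  have hc := continuous_dilatedData hp u
  rw [integral_comp_uniform (sqrt_three_mul_pos h0) hτ hu
    (g := fun x => dilatedData p₀ p₁ u (1 - x)) (by fun_prop),
    intervalIntegral.integral_comp_sub_left (dilatedData p₀ p₁ u) 1,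
    intervalIntegral.integral_eq_sub_of_hasDerivAt
      (fun x _ => hasDerivAt_cube_mul hp u x) (hc.intervalIntegrable _ _), meanUnbiasData, C1,
    div_eq_inv_mul, mul_assoc, sub_neg_eq_add]

lemma one_sub_mem_Icc {η : ℝ} (h1 : η ^ 2 ≤ 1 / 12) {x : ℝ} (hx : x ∈ Icc (-(√3 * η)) (√3 * η)) :
    1 - x ∈ Icc (1 / 2 : ℝ) (3 / 2) := by
  have := sqrt_three_mul_le h1
  exact ⟨by linarith [hx.2], by linarith [hx.1]⟩

/-- The dilations contribute a variance of order `η² / M`: the data depend on the dilation factor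
in a Lipschitz way, and the dilations are independent. -/
lemma lintegral_average_dilatedData_le [IsProbabilityMeasure P] (hM : 0 < M) {η : ℝ} (h0 : 0 < η)
    (h1 : η ^ 2 ≤ 1 / 12) (hp : BoundedDerivs K p₀ p₁ p₂ p₃) {τ : Fin M → S → ℝ}
    (hτ : ∀ j, Measurable (τ j)) (hi : iIndepFun τ P)
    (hu : ∀ j, pdf.IsUniform (τ j) (Icc (-(√3 * η)) (√3 * η)) P volume) {R u : ℝ}
    (huR : |u| ≤ R) :
    ∫⁻ s, ‖(1 / (M : ℝ)) * ∑ j, (dilatedData p₀ p₁ u (1 - τ j s) - meanUnbiasData η p₀ u)‖ₑ ^ 2 ∂P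
      ≤ ENNReal.ofReal (dilatedDataConst K R ^ 2 * (3 * η ^ 2) / M) := by
  have hc := continuous_dilatedData hp u
  have hcm : Measurable fun x => dilatedData p₀ p₁ u (1 - x) :=
    (by fun_prop : Continuous fun x => dilatedData p₀ p₁ u (1 - x)).measurable
  have hm : ∀ j, Measurable fun s => dilatedData p₀ p₁ u (1 - τ j s) := fun j => hcm.comp (hτ j)
  have hD : 0 ≤ dilatedDataConst K R := by
    have := hp.nonneg
    have : 0 ≤ R := (abs_nonneg u).trans huR
    unfold dilatedDataConst; positivity
  have hd : ∀ j, ∀ᵐ s ∂P, |dilatedData p₀ p₁ u (1 - τ j s) - dilatedData p₀ p₁ u 1| ≤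
      dilatedDataConst K R * (√3 * η) := fun j => by
    filter_upwards [ae_mem_Icc_of_uniform (hτ j) (hu j)] with s hs
    refine (abs_dilatedData_sub_le hp huR (one_sub_mem_Icc h1 hs)).trans ?_
    gcongr
    rw [sub_sub_cancel_left, abs_neg]
    exact abs_le.2 hs
  have hL2 : ∀ j, MemLp (fun s => dilatedData p₀ p₁ u (1 - τ j s)) 2 P := fun j => by
    refine MemLp.of_bound (hm j).aestronglyMeasurable
      (dilatedDataConst K R * (√3 * η) + |dilatedData p₀ p₁ u 1|) ?_
    filter_upwards [hd j] with s hs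
    have := abs_sub_abs_le_abs_sub (dilatedData p₀ p₁ u (1 - τ j s)) (dilatedData p₀ p₁ u 1)
    rw [Real.norm_eq_abs]
    linarith
  have hmean := fun j => integral_dilatedData h0 hp (hτ j) (hu j) u
  refine lintegral_enorm_sq_average_le
    (Z := fun j s => dilatedData p₀ p₁ u (1 - τ j s) - meanUnbiasData η p₀ u) hM
    (fun j => (hL2 j).sub (memLp_const _)) ?_ ?_
  · intro i j hij
    have hind : IndepFun (fun s => dilatedData p₀ p₁ u (1 - τ i s) - meanUnbiasData η p₀ u)
        (fun s => dilatedData p₀ p₁ u (1 - τ j s) - meanUnbiasData η p₀ u) P :=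
      (hi.indepFun hij).comp (hcm.sub_const _) (hcm.sub_const _)
    rw [hind.integral_fun_mul_eq_mul_integral ((hm i).sub_const _).aestronglyMeasurable
      ((hm j).sub_const _).aestronglyMeasurable,
      integral_sub ((hL2 i).integrable (by norm_num)) (integrable_const _), hmean i]
    simp
  · intro j
    have hv : ∫ s, (dilatedData p₀ p₁ u (1 - τ j s) - meanUnbiasData η p₀ u) ^ 2 ∂P =
        Var[fun s => dilatedData p₀ p₁ u (1 - τ j s); P] := by
      rw [variance_eq_integral (hm j).aemeasurable, hmean j]
    rw [hv, ← variance_sub_const (hm j).aestronglyMeasurable (dilatedData p₀ p₁ u 1)]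
    refine (variance_le_expectation_sq ((hm j).sub_const _).aestronglyMeasurable).trans ?_
    have hb : ∫ s, (dilatedData p₀ p₁ u (1 - τ j s) - dilatedData p₀ p₁ u 1) ^ 2 ∂P ≤
        ∫ _s, dilatedDataConst K R ^ 2 * (3 * η ^ 2) ∂P := by
      refine integral_mono_ae ((hL2 j).sub (memLp_const _)).integrable_sq (integrable_const _) ?_
      filter_upwards [hd j] with s hs
      have h3 : (√3 * η) ^ 2 = 3 * η ^ 2 := by rw [mul_pow, Real.sq_sqrt (by norm_num)]
      rw [← h3, ← mul_pow, ← sq_abs]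
      gcongr
    simpa using hb

end Dilations

/-! ### Moments of white noise -/

/-- The fourth moment of a standard Gaussian variable. -/
def gaussianFourthMoment : ℝ := ∫ x, x ^ 4 ∂gaussianReal 0 1

lemma gaussianFourthMoment_nonneg : 0 ≤ gaussianFourthMoment :=
  integral_nonneg fun x => by positivity

lemma integral_pow_four_gaussianReal (v : NNReal) :
    ∫ x, x ^ 4 ∂gaussianReal 0 v = (v : ℝ) ^ 2 * gaussianFourthMoment := by
  have h := gaussianReal_map_const_mul (μ := 0) (v := 1) (√(v : ℝ))
  have e : (NNReal.mk (√(v : ℝ) ^ 2) (sq_nonneg _)) * 1 = v := by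
    ext
    simp
  rw [mul_zero, e] at h
  rw [← h, integral_map (by fun_prop) (by fun_prop), gaussianFourthMoment, ← integral_const_mul]
  refine integral_congr_ae (Filter.Eventually.of_forall fun x => ?_)
  have : √(v : ℝ) ^ 4 = (v : ℝ) ^ 2 := by
    rw [show 4 = 2 * 2 from rfl, pow_mul, Real.sq_sqrt v.coe_nonneg]
  simp only [mul_pow, this]

section WhiteNoise

variable {σ : ℝ} {ε : BoxL2 → S → ℝ}

lemma IsWhiteNoise.memLp (h : IsWhiteNoise σ ε P) (φ : BoxL2) {p : ℝ≥0∞} (hp : p ≠ ∞) :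
    MemLp (ε φ) p P := (h.gaussian.hasGaussianLaw_eval φ).memLp hp

lemma IsWhiteNoise.integral_sq (h : IsWhiteNoise σ ε P) (φ : BoxL2) :
    ∫ s, ε φ s ^ 2 ∂P = σ ^ 2 * ‖φ‖ ^ 2 := by
  rw [← real_inner_self_eq_norm_sq, ← h.covariance]
  simp only [sq]

lemma IsWhiteNoise.integral_pow_four [IsProbabilityMeasure P] (h : IsWhiteNoise σ ε P)
    (φ : BoxL2) : ∫ s, ε φ s ^ 4 ∂P = (σ ^ 2 * ‖φ‖ ^ 2) ^ 2 * gaussianFourthMoment := by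
  have hv : Var[ε φ; P] = σ ^ 2 * ‖φ‖ ^ 2 := by
    rw [variance_eq_integral (h.measurable φ).aemeasurable, h.mean_zero, ← h.integral_sq]
    simp
  have hmap := (h.gaussian.hasGaussianLaw_eval φ).map_eq_gaussianReal
  rw [h.mean_zero φ, hv] at hmap
  have h4 := integral_map (μ := P) (h.measurable φ).aemeasurable
    (f := fun x : ℝ => x ^ 4) (by fun_prop)
  rw [← h4, hmap, integral_pow_four_gaussianReal, Real.coe_toNNReal _ (by positivity)]

lemma norm_sq_toLp {g : ℝ → ℝ} (hg : MemLp g 2 ((volume : Measure ℝ).restrict box)) :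
    ‖hg.toLp‖ ^ 2 = ∫ x in box, g x ^ 2 := by
  rw [← real_inner_self_eq_norm_sq, L2.inner_def]
  refine integral_congr_ae ?_
  filter_upwards [hg.coeFn_toLp] with x hx
  rw [hx]
  simp [sq]

lemma norm_sq_cos_add_norm_sq_sin (ω : ℝ) :
    ‖(memLp_cos ω).toLp‖ ^ 2 + ‖(memLp_sin ω).toLp‖ ^ 2 = 1 := by
  rw [norm_sq_toLp, norm_sq_toLp, ← integral_add (memLp_cos ω).integrable_sq
    (memLp_sin ω).integrable_sq]
  simp
  norm_num

/-- The centred random part of `|ε̂(ω)|²`. -/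
def noisePower (σ : ℝ) (x y : ℝ) : ℝ := x ^ 2 + y ^ 2 - σ ^ 2

lemma IsWhiteNoise.memLp_noisePower [IsProbabilityMeasure P] (h : IsWhiteNoise σ ε P)
    (φ ψ : BoxL2) : MemLp (fun s => noisePower σ (ε φ s) (ε ψ s)) 2 P := by
  have hsq : ∀ φ, MemLp (fun s => ε φ s ^ 2) 2 P := fun φ => by
    have := (h.memLp φ (p := 4) (by simp)).mul' (r := 2) (h.memLp φ (p := 4) (by simp))
      (hpqr := ⟨by
        rw [← two_mul, ← div_eq_mul_inv]
        rw [show (4 : ℝ≥0∞) = 2 * 2 by norm_num, ENNReal.div_eq_inv_mul,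
          ENNReal.mul_inv (by simp) (by simp), mul_assoc, ENNReal.inv_mul_cancel (by simp)
          (by simp), mul_one]⟩)
    simpa only [sq] using this
  exact ((hsq φ).add (hsq ψ)).sub (memLp_const _)

lemma IsWhiteNoise.integral_noisePower [IsProbabilityMeasure P] (h : IsWhiteNoise σ ε P) (ω : ℝ) :
    ∫ s, noisePower σ (ε (memLp_cos ω).toLp s) (ε (memLp_sin ω).toLp s) ∂P = 0 := by
  have h1 := (h.memLp (memLp_cos ω).toLp (p := 2) (by simp)).integrable_sq
  have h2 := (h.memLp (memLp_sin ω).toLp (p := 2) (by simp)).integrable_sq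
  have h12 : Integrable (fun s => ε (memLp_cos ω).toLp s ^ 2 + ε (memLp_sin ω).toLp s ^ 2) P :=
    h1.add h2
  simp only [noisePower]
  rw [integral_sub h12 (integrable_const _), integral_add h1 h2, h.integral_sq,
    h.integral_sq, ← mul_add, norm_sq_cos_add_norm_sq_sin]
  simp

/-- A bound for the second moments of `ε̂` and of `|ε̂|² - σ²`, in units of `σ⁴`. -/
def noiseConst : ℝ := 6 * gaussianFourthMoment + 4

lemma IsWhiteNoise.integral_noisePower_sq_le [IsProbabilityMeasure P] (h : IsWhiteNoise σ ε P)
    (ω : ℝ) :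
    ∫ s, noisePower σ (ε (memLp_cos ω).toLp s) (ε (memLp_sin ω).toLp s) ^ 2 ∂P ≤
      noiseConst * σ ^ 4 := by
  have hn := norm_sq_cos_add_norm_sq_sin ω
  set φ := (memLp_cos ω).toLp
  set ψ := (memLp_sin ω).toLp
  have hi : ∀ φ, Integrable (fun s => ε φ s ^ 4) P := fun φ => by
    have := (h.memLp φ (p := (4 : ℕ)) (by simp)).integrable_norm_pow (by norm_num)
    simpa only [Real.norm_eq_abs, Even.pow_abs (by decide : Even 4)] using this
  have h4 : ∀ φ : BoxL2, ‖φ‖ ^ 2 ≤ 1 →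
      ∫ s, ε φ s ^ 4 ∂P ≤ gaussianFourthMoment * σ ^ 4 := fun φ hφ => by
    have hφ2 : (‖φ‖ ^ 2) ^ 2 ≤ 1 := pow_le_one₀ (by positivity) hφ
    have hσ4 : 0 ≤ σ ^ 4 := by positivity
    rw [h.integral_pow_four φ, mul_comm]
    refine mul_le_mul_of_nonneg_left ?_ gaussianFourthMoment_nonneg
    calc _ = σ ^ 4 * (‖φ‖ ^ 2) ^ 2 := by ring
      _ ≤ _ := mul_le_of_le_one_right hσ4 hφ2
  have hi2 : Integrable (fun s => ε φ s ^ 4 + ε ψ s ^ 4) P := (hi φ).add (hi ψ)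
  calc _ ≤ ∫ s, 3 * (ε φ s ^ 4 + ε ψ s ^ 4 + σ ^ 4) ∂P := by
        refine integral_mono (h.memLp_noisePower φ ψ).integrable_sq
          ((((hi φ).add (hi ψ)).add (integrable_const _)).const_mul 3) fun s => ?_
        simp only [noisePower]
        nlinarith [sq_nonneg (ε φ s ^ 2 - ε ψ s ^ 2), sq_nonneg (ε φ s ^ 2 + σ ^ 2),
          sq_nonneg (ε ψ s ^ 2 + σ ^ 2)]
    _ = 3 * ((∫ s, ε φ s ^ 4 ∂P) + (∫ s, ε ψ s ^ 4 ∂P) + σ ^ 4) := by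
        rw [integral_const_mul, integral_add hi2 (integrable_const _),
          integral_add (hi φ) (hi ψ)]
        simp
    _ ≤ 3 * (gaussianFourthMoment * σ ^ 4 + gaussianFourthMoment * σ ^ 4 + σ ^ 4) := by
        have e1 := h4 φ (by linarith [sq_nonneg ‖ψ‖])
        have e2 := h4 ψ (by linarith [sq_nonneg ‖φ‖])
        linarith
    _ ≤ _ := by
        rw [noiseConst]
        nlinarith [pow_nonneg (sq_nonneg σ) 2]

lemma IsWhiteNoise.integral_sq_le (h : IsWhiteNoise σ ε P) (hσ : 1 ≤ σ) {φ : BoxL2}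
    (hφ : ‖φ‖ ^ 2 ≤ 1) : ∫ s, ε φ s ^ 2 ∂P ≤ noiseConst * σ ^ 4 := by
  rw [h.integral_sq]
  have h1 : σ ^ 2 ≤ σ ^ 4 := pow_le_pow_right₀ hσ (by norm_num)
  have h2 := gaussianFourthMoment_nonneg
  calc _ ≤ σ ^ 2 * 1 := by gcongr
    _ ≤ 1 * σ ^ 4 := by linarith
    _ ≤ _ := by
        gcongr
        rw [noiseConst]
        linarith

end WhiteNoise

end

section

variable {S : Type*} [MeasurableSpace S] {P : Measure S} {M : ℕ}

/-! ### Averages of noise with random coefficients -/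

/-- Averages of products of bounded coefficients `c l (U j)` with centred variables `H l (W j)`:
when the `W j` are independent of each other and of the `U j`, distinct summands are uncorrelated,
whatever the joint law of the `U j`. -/
lemma lintegral_average_sum_mul_le {κ E F : Type*} [Fintype κ] [MeasurableSpace E]
    [MeasurableSpace F] (hM : 0 < M) {U : Fin M → S → E}
    {W : Fin M → S → F} (hU : ∀ j, Measurable (U j)) (hW : ∀ j, Measurable (W j))
    (hind : iIndepFun W P) (hUW : IndepFun (fun s j => U j s) (fun s j => W j s) P)
    {c : κ → E → ℝ} {H : κ → F → ℝ} (hc : ∀ l, Measurable (c l)) (hH : ∀ l, Measurable (H l))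
    {A V : ℝ} (hA0 : 0 ≤ A) (hA : ∀ j l, ∀ᵐ s ∂P, c l (U j s) ^ 2 ≤ A)
    (hL2 : ∀ j l, MemLp (fun s => H l (W j s)) 2 P) (h0 : ∀ j l, ∫ s, H l (W j s) ∂P = 0)
    (hV : ∀ j l, ∫ s, H l (W j s) ^ 2 ∂P ≤ V) :
    ∫⁻ s, ‖(1 / (M : ℝ)) * ∑ j, ∑ l, c l (U j s) * H l (W j s)‖ₑ ^ 2 ∂P ≤
      ENNReal.ofReal (Fintype.card κ ^ 2 * (A * V) / M) := by
  have hcU : ∀ j l, Measurable fun s => c l (U j s) := fun j l => (hc l).comp (hU j)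
  have hHW : ∀ j l, Measurable fun s => H l (W j s) := fun j l => (hH l).comp (hW j)
  have hterm : ∀ j l, MemLp (fun s => c l (U j s) * H l (W j s)) 2 P := fun j l => by
    refine (hL2 j l).of_le_mul (c := √A) ((hcU j l).mul (hHW j l)).aestronglyMeasurable ?_
    filter_upwards [hA j l] with s hs
    rw [norm_mul]
    gcongr
    exact Real.abs_le_sqrt hs
  refine lintegral_enorm_sq_average_le (Z := fun j s => ∑ l, c l (U j s) * H l (W j s)) hM
    (fun j => memLp_finsetSum _ fun l _ => hterm j l) (fun i j hij => ?_) (fun j => ?_)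
  · have hlm : ∀ l m, ∫ s, (c l (U i s) * H l (W i s)) * (c m (U j s) * H m (W j s)) ∂P = 0 := by
      intro l m
      have e : ∀ s, (c l (U i s) * H l (W i s)) * (c m (U j s) * H m (W j s)) =
          (c l (U i s) * c m (U j s)) * (H l (W i s) * H m (W j s)) := fun s => by ring
      simp only [e]
      have i1 : IndepFun (fun s => c l (U i s) * c m (U j s))
          (fun s => H l (W i s) * H m (W j s)) P :=
        hUW.comp (φ := fun x : Fin M → E => c l (x i) * c m (x j))
          (ψ := fun x : Fin M → F => H l (x i) * H m (x j))
          (((hc l).comp (measurable_pi_apply i)).mul ((hc m).comp (measurable_pi_apply j)))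
          (((hH l).comp (measurable_pi_apply i)).mul ((hH m).comp (measurable_pi_apply j)))
      have i2 : IndepFun (fun s => H l (W i s)) (fun s => H m (W j s)) P :=
        (hind.indepFun hij).comp (hH l) (hH m)
      rw [i1.integral_fun_mul_eq_mul_integral
        ((hcU i l).mul (hcU j m)).aestronglyMeasurable
        ((hHW i l).mul (hHW j m)).aestronglyMeasurable,
        i2.integral_fun_mul_eq_mul_integral (hHW i l).aestronglyMeasurable
        (hHW j m).aestronglyMeasurable, h0 i l]
      simp
    have hint : ∀ l m, Integrable
        (fun s => (c l (U i s) * H l (W i s)) * (c m (U j s) * H m (W j s))) P := fun l m =>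
      (hterm i l).integrable_mul (hterm j m)
    simp only [Finset.sum_mul_sum]
    rw [integral_finsetSum _ fun l _ => integrable_finsetSum _ fun m _ => hint l m]
    refine Finset.sum_eq_zero fun l _ => ?_
    rw [integral_finsetSum _ fun m _ => hint l m]
    exact Finset.sum_eq_zero fun m _ => hlm l m
  · have hsq : ∀ l, Integrable (fun s => A * H l (W j s) ^ 2) P := fun l =>
      (hL2 j l).integrable_sq.const_mul A
    calc ∫ s, (∑ l, c l (U j s) * H l (W j s)) ^ 2 ∂P
        ≤ ∫ s, Fintype.card κ * ∑ l, A * H l (W j s) ^ 2 ∂P := by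
          refine integral_mono_ae
            (memLp_finsetSum Finset.univ fun l _ => hterm j l).integrable_sq
            ((integrable_finsetSum _ fun l _ => hsq l).const_mul _) ?_
          filter_upwards [ae_all_iff.2 fun l => hA j l] with s hs
          refine (sq_sum_le_card_mul_sum_sq (s := Finset.univ)).trans ?_
          rw [Finset.card_univ]
          gcongr with l
          rw [mul_pow]
          gcongr
          exact hs l
      _ = Fintype.card κ * ∑ l, A * ∫ s, H l (W j s) ^ 2 ∂P := by
          rw [integral_const_mul, integral_finsetSum _ fun l _ => hsq l]
          simp only [integral_const_mul]
      _ ≤ Fintype.card κ * ∑ _l : κ, A * V := by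
          gcongr with l
          exact hV j l
      _ = _ := by
          rw [Finset.sum_const, Finset.card_univ, nsmul_eq_mul]
          ring

/-! ### Signal and noise parts of the data -/

/-- The Fourier transform at `v` of the signal translated by `x.1` and dilated by `x.2 < 1`. -/
def dilatedFourier (f : ℝ → ℝ) (x : ℝ × ℝ) (v : ℝ) : ℂ :=
  ((1 - x.2 : ℝ) : ℂ) * Complex.exp (((-(x.1 * v) : ℝ) : ℂ) * Complex.I) *
    fourier f ((1 - x.2) * v)

/-- The contribution of noise with Fourier transform `e` at `v` to the power spectrum, with the
mean `σ²` removed. -/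
def noiseTerm (f : ℝ → ℝ) (σ : ℝ) (x : ℝ × ℝ) (e : ℂ) (v : ℝ) : ℝ :=
  2 * ((dilatedFourier f x v).re * e.re + (dilatedFourier f x v).im * e.im) + (‖e‖ ^ 2 - σ ^ 2)

/-- The mean of the power spectra of the noiseless observations. -/
def meanSignal (f : ℝ → ℝ) (τ : Fin M → S → ℝ) (s : S) (v : ℝ) : ℝ :=
  (1 / (M : ℝ)) * ∑ j, (1 - τ j s) ^ 2 * powerSpectrum f ((1 - τ j s) * v)

/-- The part of the data caused by the noise. -/
def meanNoise (f : ℝ → ℝ) (σ : ℝ) (t τ : Fin M → S → ℝ) (ε : Fin M → BoxL2 → S → ℝ) (s : S)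
    (v : ℝ) : ℝ :=
  (1 / (M : ℝ)) * ∑ j, noiseTerm f σ (t j s, τ j s) (noiseFourier (ε j) v s) v

variable {f : ℝ → ℝ} {η σ : ℝ} {t τ : Fin M → S → ℝ} {ε : Fin M → BoxL2 → S → ℝ}

lemma norm_add_sq_eq (f : ℝ → ℝ) (σ : ℝ) (x : ℝ × ℝ) (e : ℂ) (v : ℝ) :
    ‖dilatedFourier f x v + e‖ ^ 2 =
      (1 - x.2) ^ 2 * powerSpectrum f ((1 - x.2) * v) + noiseTerm f σ x e v + σ ^ 2 := by
  rw [← norm_sq_fourier_dilatedSignal x.2 x.1 v, noiseTerm]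
  change _ = ‖dilatedFourier f x v‖ ^ 2 + _ + _
  simp only [← Complex.normSq_eq_norm_sq, Complex.normSq_apply, Complex.add_re, Complex.add_im]
  ring

lemma meanPowerSpectrum_eq {S : Type*} {t τ : Fin M → S → ℝ} {ε : Fin M → BoxL2 → S → ℝ}
    (hM : 0 < M) {s : S} (hs : ∀ j, τ j s < 1) :
    meanPowerSpectrum f σ t τ ε s = fun v => meanSignal f τ s v + meanNoise f σ t τ ε s v := by
  have hM' : (M : ℝ) ≠ 0 := by exact_mod_cast hM.ne'
  ext v
  have e : ∀ j, observedPowerSpectrum f t τ ε j s v =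
      (1 - τ j s) ^ 2 * powerSpectrum f ((1 - τ j s) * v) +
        noiseTerm f σ (t j s, τ j s) (noiseFourier (ε j) v s) v + σ ^ 2 := fun j => by
    rw [observedPowerSpectrum, fourier_dilatedSignal (hs j),
      ← norm_add_sq_eq f σ (t j s, τ j s) (noiseFourier (ε j) v s) v]
    rfl
  have hs : (1 / (M : ℝ)) * ∑ _j : Fin M, σ ^ 2 = σ ^ 2 := by
    simp
    field_simp
  simp only [meanPowerSpectrum, meanSignal, meanNoise, e, Finset.sum_add_distrib, mul_add]
  rw [hs, add_sub_cancel_right]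

lemma measurable_dilatedFourier (hc : Continuous (fourier f)) :
    Measurable fun z : (ℝ × ℝ) × ℝ => dilatedFourier f z.1 z.2 := by
  unfold dilatedFourier
  exact Continuous.measurable (by fun_prop)

lemma measurable_meanSignal (hc : Continuous (fourier f)) (hτ : ∀ j, Measurable (τ j)) :
    Measurable (Function.uncurry (meanSignal f τ)) := by
  have hp : Measurable (powerSpectrum f) := (hc.norm.pow 2).measurable
  unfold meanSignal Function.uncurry
  refine Measurable.const_mul (Finset.measurable_sum _ fun j _ => ?_) _
  have h1 : Measurable fun z : S × ℝ => 1 - τ j z.1 := ((hτ j).comp measurable_fst).const_sub 1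
  exact (h1.pow_const 2).mul (hp.comp (h1.mul measurable_snd))

lemma measurable_meanNoise (hc : Continuous (fourier f)) (ht : ∀ j, Measurable (t j))
    (hτ : ∀ j, Measurable (τ j))
    (hε : ∀ j, Measurable (Function.uncurry (noiseFourier (ε j)))) :
    Measurable (Function.uncurry (meanNoise f σ t τ ε)) := by
  unfold meanNoise Function.uncurry
  refine Measurable.const_mul (Finset.measurable_sum _ fun j _ => ?_) _
  have h1 : Measurable fun z : S × ℝ => dilatedFourier f (t j z.1, τ j z.1) z.2 := by
    have h := (measurable_dilatedFourier hc).comp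
      ((((ht j).comp measurable_fst).prodMk ((hτ j).comp measurable_fst)).prodMk
        (measurable_snd (α := S) (β := ℝ)))
    simpa only [Function.comp_def] using h
  have h2 : Measurable fun z : S × ℝ => noiseFourier (ε j) z.2 z.1 := by
    have h := (hε j).comp (measurable_swap (α := S) (β := ℝ))
    simpa only [Function.comp_def, Function.uncurry, Prod.fst_swap, Prod.snd_swap] using h
  have r1 : Measurable fun z : S × ℝ => (dilatedFourier f (t j z.1, τ j z.1) z.2).re :=
    Complex.measurable_re.comp h1
  have i1 : Measurable fun z : S × ℝ => (dilatedFourier f (t j z.1, τ j z.1) z.2).im :=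
    Complex.measurable_im.comp h1
  have r2 : Measurable fun z : S × ℝ => (noiseFourier (ε j) z.2 z.1).re :=
    Complex.measurable_re.comp h2
  have i2 : Measurable fun z : S × ℝ => (noiseFourier (ε j) z.2 z.1).im :=
    Complex.measurable_im.comp h2
  unfold noiseTerm
  exact (((r1.mul r2).add (i1.mul i2)).const_mul 2).add ((h2.norm.pow_const 2).sub_const _)

lemma noiseFourier_re {S : Type*} (ε : BoxL2 → S → ℝ) (v : ℝ) (s : S) :
    (noiseFourier ε v s).re = ε (memLp_cos v).toLp s := by
  simp [noiseFourier]

lemma noiseFourier_im {S : Type*} (ε : BoxL2 → S → ℝ) (v : ℝ) (s : S) :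
    (noiseFourier ε v s).im = -ε (memLp_sin v).toLp s := by
  simp [noiseFourier]

/-- The noise part of the data has second moment `O(σ⁴ / M)` at every frequency. -/
lemma lintegral_meanNoise_sq_le [IsProbabilityMeasure P] (hM : 0 < M) (h1 : η ^ 2 ≤ 1 / 12)
    (hσ : 1 ≤ σ) (hmodel : IsNoisyDilationMRA f M η σ t τ ε P) (hc : Continuous (fourier f))
    {K : ℝ} (hK : ∀ x, |powerSpectrum f x| ≤ K) (v : ℝ) :
    ∫⁻ s, ‖meanNoise f σ t τ ε s v‖ₑ ^ 2 ∂P ≤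
      ENNReal.ofReal (9 * ((1 + 9 * K) * noiseConst) * (σ ^ 4 / M)) := by
  have hK0 : 0 ≤ K := (abs_nonneg _).trans (hK 0)
  set φ := (memLp_cos v).toLp with hφ
  set ψ := (memLp_sin v).toLp with hψ
  let c : Fin 3 → ℝ × ℝ → ℝ := ![fun x => 2 * (dilatedFourier f x v).re,
    fun x => -2 * (dilatedFourier f x v).im, fun _ => 1]
  let H : Fin 3 → (BoxL2 → ℝ) → ℝ := ![fun e => e φ, fun e => e ψ,
    fun e => noisePower σ (e φ) (e ψ)]
  have hF : Measurable fun x : ℝ × ℝ => dilatedFourier f x v := by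
    have h := (measurable_dilatedFourier hc).comp
      (measurable_prodMk_right (α := ℝ × ℝ) (β := ℝ) (y := v))
    simpa only [Function.comp_def] using h
  have hmc : ∀ l, Measurable (c l) := by
    intro l
    fin_cases l
    · exact (Complex.measurable_re.comp hF).const_mul 2
    · exact (Complex.measurable_im.comp hF).const_mul (-2)
    · exact measurable_const
  have hmH : ∀ l, Measurable (H l) := by
    intro l
    have e1 : Measurable fun e : BoxL2 → ℝ => e φ := measurable_pi_apply φ
    have e2 : Measurable fun e : BoxL2 → ℝ => e ψ := measurable_pi_apply ψ
    fin_cases l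
    · exact e1
    · exact e2
    · exact ((e1.pow_const 2).add (e2.pow_const 2)).sub_const _
  have hn : ‖φ‖ ^ 2 + ‖ψ‖ ^ 2 = 1 := norm_sq_cos_add_norm_sq_sin v
  have key := lintegral_average_sum_mul_le (P := P) (κ := Fin 3) hM
    (U := fun j s => (t j s, τ j s)) (W := fun j s φ => ε j φ s)
    (fun j => (hmodel.measurable_t j).prodMk (hmodel.measurable_τ j))
    (fun j => measurable_pi_lambda _ fun φ => (hmodel.whiteNoise j).measurable φ)
    hmodel.indep_ε hmodel.indep_signal_noise (c := c) (H := H) hmc hmH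
    (A := 1 + 9 * K) (V := noiseConst * σ ^ 4) (by positivity) ?_ ?_ ?_ ?_
  · have e : ∀ s, meanNoise f σ t τ ε s v =
        (1 / (M : ℝ)) * ∑ j, ∑ l, c l (t j s, τ j s) * H l (fun φ => ε j φ s) := fun s => by
      rw [meanNoise]
      congr 1
      refine Finset.sum_congr rfl fun j _ => ?_
      rw [Fin.sum_univ_three, noiseTerm, noiseFourier_re, noiseFourier_im,
        ← Complex.normSq_eq_norm_sq, Complex.normSq_apply, noiseFourier_re, noiseFourier_im]
      simp only [c, H, noisePower, ← hφ, ← hψ, Matrix.cons_val]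
      ring
    simp only [e]
    refine key.trans (le_of_eq ?_)
    rw [Fintype.card_fin]
    congr 1
    push_cast
    ring
  · intro j l
    filter_upwards [ae_mem_Icc_of_uniform (hmodel.measurable_τ j) (hmodel.uniform_τ j)] with s hs
    have hx := one_sub_mem_Icc h1 hs
    have hb : ‖dilatedFourier f (t j s, τ j s) v‖ ^ 2 ≤ 9 / 4 * K := by
      rw [dilatedFourier, norm_sq_fourier_dilatedSignal]
      have h9 : (1 - τ j s) ^ 2 ≤ 9 / 4 := by nlinarith [hx.1, hx.2]
      exact mul_le_mul h9 ((le_abs_self _).trans (hK _)) (by unfold powerSpectrum; positivity)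
        (by norm_num)
    have hre : (dilatedFourier f (t j s, τ j s) v).re ^ 2 +
        (dilatedFourier f (t j s, τ j s) v).im ^ 2 ≤ 9 / 4 * K := by
      rw [← Complex.normSq_eq_norm_sq, Complex.normSq_apply] at hb
      linarith
    have s1 := sq_nonneg (dilatedFourier f (t j s, τ j s) v).re
    have s2 := sq_nonneg (dilatedFourier f (t j s, τ j s) v).im
    fin_cases l
    · change (2 * _) ^ 2 ≤ _
      linarith
    · change (-2 * _) ^ 2 ≤ _
      linarith
    · change (1 : ℝ) ^ 2 ≤ _
      linarith
  · intro j l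
    fin_cases l
    · exact (hmodel.whiteNoise j).memLp φ (by simp)
    · exact (hmodel.whiteNoise j).memLp ψ (by simp)
    · exact (hmodel.whiteNoise j).memLp_noisePower φ ψ
  · intro j l
    fin_cases l
    · exact (hmodel.whiteNoise j).mean_zero φ
    · exact (hmodel.whiteNoise j).mean_zero ψ
    · exact (hmodel.whiteNoise j).integral_noisePower v
  · intro j l
    fin_cases l
    · exact (hmodel.whiteNoise j).integral_sq_le hσ (by linarith [sq_nonneg ‖ψ‖])
    · exact (hmodel.whiteNoise j).integral_sq_le hσ (by linarith [sq_nonneg ‖φ‖])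
    · exact (hmodel.whiteNoise j).integral_noisePower_sq_le v

end

section

variable {S : Type*} [MeasurableSpace S] {P : Measure S} {M : ℕ}
variable {f : ℝ → ℝ} {η σ L : ℝ} {t τ : Fin M → S → ℝ} {ε : Fin M → BoxL2 → S → ℝ}

/-! ### Decomposition of the error of the smoothed data -/

lemma abs_average_le {M : ℕ} {a : Fin M → ℝ} {B : ℝ} (hM : 0 < M) (ha : ∀ j, |a j| ≤ B) :
    |(1 / (M : ℝ)) * ∑ j, a j| ≤ B := by
  have hM' : (0 : ℝ) < M := by exact_mod_cast hM
  rw [abs_mul, abs_of_pos (by positivity)]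
  calc _ ≤ (1 / (M : ℝ)) * ∑ _j : Fin M, B := by
        gcongr
        exact (Finset.abs_sum_le_sum_abs _ _).trans (Finset.sum_le_sum fun j _ => ha j)
    _ = B := by
        simp
        field_simp

/-- Averages of dilates of a function with bounded derivatives, with dilation factors `x j` of
size at most `3 / 2`, again have bounded derivatives. -/
lemma BoundedDerivs.average {K : ℝ} {p₀ p₁ p₂ p₃ : ℝ → ℝ} (hp : BoundedDerivs K p₀ p₁ p₂ p₃)
    (hM : 0 < M) {x : Fin M → ℝ} (hx : ∀ j, x j ∈ Icc (1 / 2 : ℝ) (3 / 2)) :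
    BoundedDerivs (8 * K) (fun v => (1 / (M : ℝ)) * ∑ j, x j ^ 2 * p₀ (x j * v))
      (fun v => (1 / (M : ℝ)) * ∑ j, x j ^ 3 * p₁ (x j * v))
      (fun v => (1 / (M : ℝ)) * ∑ j, x j ^ 4 * p₂ (x j * v))
      (fun v => (1 / (M : ℝ)) * ∑ j, x j ^ 5 * p₃ (x j * v)) := by
  have hder : ∀ {q q' : ℝ → ℝ} (n : ℕ), (∀ y, HasDerivAt q (q' y) y) → ∀ v,
      HasDerivAt (fun v => (1 / (M : ℝ)) * ∑ j, x j ^ n * q (x j * v))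
        ((1 / (M : ℝ)) * ∑ j, x j ^ (n + 1) * q' (x j * v)) v := fun {q q'} n hq v => by
    refine HasDerivAt.const_mul _ (HasDerivAt.fun_sum fun j _ => ?_)
    refine (((hq (x j * v)).comp v (hasDerivAt_const_mul (x j))).const_mul
      (x j ^ n)).congr_deriv ?_
    ring
  have hbd : ∀ {q : ℝ → ℝ} (n : ℕ), n ≤ 5 → (∀ y, |q y| ≤ K) → ∀ v,
      |(1 / (M : ℝ)) * ∑ j, x j ^ n * q (x j * v)| ≤ 8 * K := fun {q} n hn hq v => by
    refine abs_average_le hM fun j => ?_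
    have h0 : 0 ≤ x j := by linarith [(hx j).1]
    rw [abs_mul, abs_of_nonneg (by positivity)]
    have h1 : x j ^ n ≤ 8 := calc
      x j ^ n ≤ (3 / 2) ^ n := by gcongr; exact (hx j).2
      _ ≤ (3 / 2) ^ 5 := pow_le_pow_right₀ (by norm_num) hn
      _ ≤ 8 := by norm_num
    exact mul_le_mul h1 (hq _) (abs_nonneg _) (by norm_num)
  exact ⟨hder 2 hp.deriv₀, hder 3 hp.deriv₁, hder 4 hp.deriv₂, hbd 2 (by norm_num) hp.bound₀,
    hbd 3 (by norm_num) hp.bound₁, hbd 4 (by norm_num) hp.bound₂, hbd 5 (by norm_num) hp.bound₃⟩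

/-- The weight `3 φ_L(u - v) + R |φ_L'(u - v)|` with which noise at frequency `v` affects the
smoothed data at `u`, for `|u| ≤ R`. -/
def noiseWeight (L R u v : ℝ) : ℝ :=
  3 * gaussianFilter L (u - v) + R * |gaussianFilterDeriv L (u - v)|

lemma noiseWeight_nonneg {R : ℝ} (hR : 0 ≤ R) (u v : ℝ) : 0 ≤ noiseWeight L R u v := by
  have := gaussianFilter_nonneg L (u - v)
  unfold noiseWeight; positivity

lemma continuous_noiseWeight (L R u : ℝ) : Continuous (noiseWeight L R u) := by
  have := continuous_gaussianFilter L
  have := continuous_gaussianFilterDeriv L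
  unfold noiseWeight; fun_prop

lemma lintegral_noiseWeight_le (hL : 0 < L) {R : ℝ} (hR : 0 ≤ R) (u : ℝ) :
    ∫⁻ v, ENNReal.ofReal (noiseWeight L R u v) ≤ ENNReal.ofReal (3 + R * L⁻¹) := by
  have i1 := ((integrable_gaussianFilter hL).comp_sub_left u).const_mul 3
  have i2 := ((integrable_gaussianFilterDeriv hL).abs.comp_sub_left u).const_mul R
  have i12 : Integrable (noiseWeight L R u) := i1.add i2
  rw [← ofReal_integral_eq_lintegral_ofReal i12
    (Filter.Eventually.of_forall fun v => noiseWeight_nonneg hR u v)]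
  refine ENNReal.ofReal_le_ofReal ?_
  simp only [noiseWeight]
  rw [integral_add i1 i2, integral_const_mul, integral_const_mul,
    integral_sub_left_eq_self (gaussianFilter L) volume u,
    integral_sub_left_eq_self (fun x => |gaussianFilterDeriv L x|) volume u,
    integral_gaussianFilter hL]
  have := integral_abs_gaussianFilterDeriv_le hL
  rw [mul_one]
  gcongr

/-- The error of the smoothed data, split into the fluctuation of the dilations, the bias of the
smoothing and the noise. -/
lemma enorm_meanUnbiasData_sub_le {K : ℝ} {p₀ p₁ p₂ p₃ : ℝ → ℝ}
    (hp : BoundedDerivs K p₀ p₁ p₂ p₃) (hM : 0 < M) (hL : 0 < L) {x : Fin M → ℝ}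
    (hx : ∀ j, x j ∈ Icc (1 / 2 : ℝ) (3 / 2)) {N : ℝ → ℝ} (hN : Measurable N)
    (hNi : Integrable (fun v => N v * gaussianWeight L v)) {R u : ℝ} (hu : |u| ≤ R) :
    ‖meanUnbiasData η p₀ u - smoothedData L
        (fun v => (1 / (M : ℝ)) * ∑ j, x j ^ 2 * p₀ (x j * v) + N v) u‖ₑ ≤
      ‖(1 / (M : ℝ)) * ∑ j, (dilatedData p₀ p₁ u (x j) - meanUnbiasData η p₀ u)‖ₑ +
        ENNReal.ofReal ((3 + R) * (8 * K) * L ^ 2) +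
        ∫⁻ v, ENNReal.ofReal (noiseWeight L R u v) * ‖N v‖ₑ := by
  have hM' : (M : ℝ) ≠ 0 := by exact_mod_cast hM.ne'
  have hR : 0 ≤ R := (abs_nonneg u).trans hu
  have hq := hp.average hM hx
  set Q := fun v => (1 / (M : ℝ)) * ∑ j, x j ^ 2 * p₀ (x j * v) with hQ
  set Q₁ := fun v => (1 / (M : ℝ)) * ∑ j, x j ^ 3 * p₁ (x j * v) with hQ₁
  have hQm : Measurable Q := hq.continuous₀.measurable
  have hQi := hq.integrable_mul_gaussianWeight hL
  have hadd : smooth L (fun v => Q v + N v) = fun u => smooth L Q u + smooth L N u := by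
    ext u
    simp only [smooth_apply, add_mul]
    exact integral_add (integrable_mul_gaussianFilter hL hQm hQi u)
      (integrable_mul_gaussianFilter hL hN hNi u)
  have hdQ := hasDerivAt_smooth hL hQm hQi u
  have hdN := hasDerivAt_smooth hL hN hNi u
  have hderiv : deriv (smooth L fun v => Q v + N v) u = deriv (smooth L Q) u +
      ∫ v, N v * gaussianFilterDeriv L (u - v) := by
    rw [hadd, hdQ.deriv]
    exact (hdQ.add hdN).deriv
  have havg : (1 / (M : ℝ)) * ∑ j, (dilatedData p₀ p₁ u (x j) - meanUnbiasData η p₀ u) =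
      3 * Q u + u * Q₁ u - meanUnbiasData η p₀ u := by
    have e : (1 / (M : ℝ)) * ∑ _j : Fin M, meanUnbiasData η p₀ u = meanUnbiasData η p₀ u := by
      simp
      field_simp
    rw [Finset.sum_sub_distrib, mul_sub, e]
    simp only [hQ, hQ₁, dilatedData, Finset.sum_add_distrib, ← Finset.mul_sum]
    ring
  have hsplit : meanUnbiasData η p₀ u - smoothedData L (fun v => Q v + N v) u =
      -((1 / (M : ℝ)) * ∑ j, (dilatedData p₀ p₁ u (x j) - meanUnbiasData η p₀ u)) +
        -(3 * (smooth L Q u - Q u) + u * (deriv (smooth L Q) u - Q₁ u)) +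
        -∫ v, (3 * (N v * gaussianFilter L (u - v)) +
          u * (N v * gaussianFilterDeriv L (u - v))) := by
    rw [havg, smoothedData, hderiv, hadd,
      integral_add ((integrable_mul_gaussianFilter hL hN hNi u).const_mul 3)
        ((integrable_mul_gaussianFilterDeriv hL hN hNi u).const_mul u), integral_const_mul,
      integral_const_mul, ← smooth_apply L N]
    ring
  rw [hsplit]
  refine (enorm_add_le _ _).trans (add_le_add ((enorm_add_le _ _).trans (add_le_add ?_ ?_)) ?_)
  · rw [enorm_neg]
  · rw [enorm_neg, Real.enorm_eq_ofReal_abs]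
    refine ENNReal.ofReal_le_ofReal ((abs_add_le _ _).trans ?_)
    rw [abs_mul, abs_mul, abs_of_pos (by norm_num : (0 : ℝ) < 3)]
    have b1 := hq.abs_smooth_sub_le hL u
    have b2 := hq.abs_deriv_smooth_sub_le hL u
    calc _ ≤ 3 * (8 * K * L ^ 2) + R * (8 * K * L ^ 2) := by gcongr
      _ = _ := by ring
  · rw [enorm_neg]
    refine (enorm_integral_le_lintegral_enorm _).trans (lintegral_mono fun v => ?_)
    rw [Real.enorm_eq_ofReal_abs, Real.enorm_eq_ofReal_abs,
      ← ENNReal.ofReal_mul (noiseWeight_nonneg hR u v)]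
    refine ENNReal.ofReal_le_ofReal ((abs_add_le _ _).trans ?_)
    rw [abs_mul, abs_mul, abs_mul, abs_mul, abs_of_nonneg (gaussianFilter_nonneg L _),
      abs_of_pos (by norm_num : (0 : ℝ) < 3), noiseWeight, add_mul]
    have : |u| * (|N v| * |gaussianFilterDeriv L (u - v)|) ≤
        R * (|N v| * |gaussianFilterDeriv L (u - v)|) := by gcongr
    linarith

end

section

variable {S : Type*} [MeasurableSpace S] {P : Measure S} {M : ℕ}
variable {f : ℝ → ℝ} {η σ L : ℝ} {t τ : Fin M → S → ℝ} {ε : Fin M → BoxL2 → S → ℝ}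

/-! ### Measurable versions of the error -/

lemma measurable_integral_mul_comp_sub {h : S → ℝ → ℝ} (hh : Measurable (Function.uncurry h))
    {g : ℝ → ℝ} (hg : Measurable g) :
    Measurable fun z : S × ℝ => ∫ v, h z.1 v * g (z.2 - v) := by
  have h1 : Measurable fun y : (S × ℝ) × ℝ => h y.1.1 y.2 :=
    hh.comp ((measurable_fst.comp measurable_fst).prodMk measurable_snd)
  have h2 : Measurable fun y : (S × ℝ) × ℝ => g (y.1.2 - y.2) :=
    hg.comp ((measurable_snd.comp measurable_fst).sub measurable_snd)
  exact ((h1.mul h2).stronglyMeasurable.integral_prod_right' (ν := volume)).measurable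

/-- The error of the smoothed data `h s` at `u`, with the derivative of the smoothed data written
as an integral, so that it is jointly measurable. -/
def dataError (η L : ℝ) (p : ℝ → ℝ) (h : S → ℝ → ℝ) (s : S) (u : ℝ) : ℝ :=
  meanUnbiasData η p u - (3 * (∫ v, h s v * gaussianFilter L (u - v)) +
    u * ∫ v, h s v * gaussianFilterDeriv L (u - v))

/-- The error of the inversion at `ω`; the series is an integral with respect to the counting
measure, so that it is jointly measurable. -/
def inversionError (η L : ℝ) (p : ℝ → ℝ) (h : S → ℝ → ℝ) (s : S) (ω : ℝ) : ℝ :=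
  ∫ i, seriesWeight η i * dataError η L p h s (seriesFreq η ω i) ∂(Measure.count : Measure ℕ)

variable {p : ℝ → ℝ} {h : S → ℝ → ℝ}

lemma measurable_dataError (hp : Measurable p) (hh : Measurable (Function.uncurry h)) :
    Measurable fun z : S × ℝ => dataError η L p h z.1 z.2 := by
  have h1 := measurable_integral_mul_comp_sub hh (continuous_gaussianFilter L).measurable
  have h2 := measurable_integral_mul_comp_sub hh (continuous_gaussianFilterDeriv L).measurable
  have h3 : Measurable (meanUnbiasData η p) := by
    unfold meanUnbiasData
    fun_prop
  unfold dataError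
  exact (h3.comp measurable_snd).sub ((h1.const_mul 3).add (measurable_snd.mul h2))

lemma measurable_dataError_comp {α : Type*} [MeasurableSpace α] (hp : Measurable p)
    (hh : Measurable (Function.uncurry h)) {a : α → S} (ha : Measurable a) {b : α → ℝ}
    (hb : Measurable b) : Measurable fun x => dataError η L p h (a x) (b x) := by
  have h1 := (measurable_dataError (η := η) (L := L) hp hh).comp (ha.prodMk hb)
  simpa only [Function.comp_def] using h1

lemma measurable_inversionError (hp : Measurable p) (hh : Measurable (Function.uncurry h)) :
    Measurable (Function.uncurry (inversionError η L p h)) := by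
  have hm : Measurable fun y : (S × ℝ) × ℕ =>
      seriesWeight η y.2 * dataError η L p h y.1.1 (seriesFreq η y.1.2 y.2) := by
    refine measurable_from_prod_countable_left fun i => ?_
    have h1 : Measurable fun z : S × ℝ => seriesFreq η z.2 i := by
      unfold seriesFreq
      fun_prop
    exact (measurable_dataError_comp (η := η) (L := L) hp hh measurable_fst h1).const_mul
      (seriesWeight η i)
  exact (hm.stronglyMeasurable.integral_prod_right' (ν := Measure.count)).measurable

lemma dataError_eq {S : Type*} {h : S → ℝ → ℝ} (hL : 0 < L) {s : S} (hm : Measurable (h s))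
    (hi : Integrable (fun v => h s v * gaussianWeight L v)) (u : ℝ) :
    dataError η L p h s u = meanUnbiasData η p u - smoothedData L (h s) u := by
  rw [dataError, smoothedData, (hasDerivAt_smooth hL hm hi u).deriv, smooth_apply]

lemma inversionError_eq {S : Type*} {h : S → ℝ → ℝ} (hL : 0 < L) (h0 : 0 < η) (h1 : η ^ 2 ≤ 1 / 12) {s : S}
    (hm : Measurable (h s)) (hi : Integrable (fun v => h s v * gaussianWeight L v)) {K : ℝ}
    (hp : ∀ x, |p x| ≤ K) (ω : ℝ) :
    inversionError η L p h s ω = p ω - inversionUnbias η L (h s) ω := by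
  have hs := hasSum_sub_inversionUnbias hL h0 h1 hm hi hp ω
  rw [inversionError, integral_countable (integrable_count_iff.2 ?_), ← hs.tsum_eq]
  · simp [dataError_eq hL hm hi]
  · simpa only [dataError_eq hL hm hi] using hs.summable.norm

/-- A bound for the second moment of the error of the smoothed data at all frequencies in
`[-R, R]` bounds the mean square error of the inversion on `[-R, R]`. -/
lemma lintegral_inversionError_sq_le [SFinite P] (h0 : 0 < η) (h1 : η ^ 2 ≤ 1 / 12)
    (hp : Measurable p) (hh : Measurable (Function.uncurry h)) {R : ℝ} {B : ℝ≥0∞}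
    (hB : ∀ u, |u| ≤ R → ∫⁻ s, ‖dataError η L p h s u‖ₑ ^ 2 ∂P ≤ B) :
    ∫⁻ s, (∫⁻ ω in Icc (-R) R, ‖inversionError η L p h s ω‖ₑ ^ 2) ∂P ≤
      ENNReal.ofReal (2 * R) * (ENNReal.ofReal (9 / 4) * B) := by
  have hm := measurable_inversionError (η := η) (L := L) hp hh
  have hpt : ∀ ω ∈ Icc (-R) R, ∫⁻ s, ‖inversionError η L p h s ω‖ₑ ^ 2 ∂P ≤
      ENNReal.ofReal (9 / 4) * B := by
    intro ω hω
    have hX : Measurable (Function.uncurry fun s i =>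
        ‖dataError η L p h s (seriesFreq η ω i)‖ₑ) := by
      refine measurable_from_prod_countable_left fun i => ?_
      have h2 : Measurable fun s => dataError η L p h s (seriesFreq η ω i) :=
        measurable_dataError_comp (a := fun s => s) (b := fun _ => seriesFreq η ω i) hp hh
          measurable_id measurable_const
      simpa only [Function.uncurry] using h2.enorm
    have hle : ∀ s, ‖inversionError η L p h s ω‖ₑ ≤ ∫⁻ i, ENNReal.ofReal (seriesWeight η i) *
        ‖dataError η L p h s (seriesFreq η ω i)‖ₑ ∂(Measure.count : Measure ℕ) := fun s => by
      unfold inversionError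
      refine (enorm_integral_le_lintegral_enorm _).trans (lintegral_mono fun i => ?_)
      simp only
      rw [enorm_mul, Real.enorm_eq_ofReal (seriesWeight_pos h0 h1 i).le]
    calc ∫⁻ s, ‖inversionError η L p h s ω‖ₑ ^ 2 ∂P
        ≤ ∫⁻ s, (∫⁻ i, ENNReal.ofReal (seriesWeight η i) *
            ‖dataError η L p h s (seriesFreq η ω i)‖ₑ ∂(Measure.count : Measure ℕ)) ^ 2 ∂P :=
          lintegral_mono fun s => pow_le_pow_left' (hle s) 2
      _ ≤ (∫⁻ i, ENNReal.ofReal (seriesWeight η i) ∂(Measure.count : Measure ℕ)) ^ 2 * B :=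
          lintegral_sq_lintegral_mul_le P _ (measurable_of_countable _) hX fun i _ =>
            hB _ ((abs_seriesFreq_le h0 h1 ω i).trans (abs_le.2 hω))
      _ ≤ ENNReal.ofReal (3 / 2) ^ 2 * B := by
          rw [lintegral_count, ← ENNReal.ofReal_tsum_of_nonneg
            (fun i => (seriesWeight_pos h0 h1 i).le) (summable_seriesWeight h0 h1)]
          gcongr
          exact tsum_seriesWeight_le h0 h1
      _ = _ := by
          rw [← ENNReal.ofReal_pow (by norm_num)]
          norm_num
  rw [lintegral_lintegral_swap (hm.enorm.pow_const 2).aemeasurable]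
  calc _ ≤ ∫⁻ _ω in Icc (-R) R, ENNReal.ofReal (9 / 4) * B :=
        setLIntegral_mono measurable_const hpt
    _ = _ := by
        rw [setLIntegral_const, Real.volume_Icc, mul_comm]
        ring_nf

/-! ### The error of the smoothed data -/

/-- The Cauchy-Schwarz inequality on a set of three points. -/
lemma add_add_sq_le (a b c : ℝ≥0∞) : (a + b + c) ^ 2 ≤ 3 * (a ^ 2 + b ^ 2 + c ^ 2) := by
  have h := sq_lintegral_mul_le (Measure.count : Measure (Fin 3)) (w := fun _ => 1)
    (g := ![a, b, c]) aemeasurable_const (measurable_of_countable _).aemeasurable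
  simpa [lintegral_count, tsum_fintype, Fin.sum_univ_three] using h

/-- The data of the model, in the form valid almost surely. -/
def modelData (f : ℝ → ℝ) (σ : ℝ) (t τ : Fin M → S → ℝ) (ε : Fin M → BoxL2 → S → ℝ) (s : S)
    (v : ℝ) : ℝ := meanSignal f τ s v + meanNoise f σ t τ ε s v

/-- Almost surely the noise is integrable against a Gaussian weight, since its second moments are
bounded uniformly in the frequency. -/
lemma ae_integrable_meanNoise [IsProbabilityMeasure P] (hL : 0 < L)
    (hm : Measurable (Function.uncurry (meanNoise f σ t τ ε))) {B : ℝ≥0∞} (hB : B ≠ ∞)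
    (hN : ∀ v, ∫⁻ s, ‖meanNoise f σ t τ ε s v‖ₑ ^ 2 ∂P ≤ B) :
    ∀ᵐ s ∂P, Integrable fun v => meanNoise f σ t τ ε s v * gaussianWeight L v := by
  have hw := (continuous_gaussianWeight L).measurable.enorm
  have h := lintegral_sq_lintegral_mul_le P volume hw
    (X := fun s v => ‖meanNoise f σ t τ ε s v‖ₑ) hm.enorm fun v _ => hN v
  have hfin : (∫⁻ v, ‖gaussianWeight L v‖ₑ) ≠ ∞ := (integrable_gaussianWeight hL).2.ne
  have hmeas : Measurable fun s =>
      (∫⁻ v, ‖gaussianWeight L v‖ₑ * ‖meanNoise f σ t τ ε s v‖ₑ) ^ 2 :=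
    (Measurable.lintegral_prod_right (ν := volume)
      ((hw.comp measurable_snd).mul hm.enorm)).pow_const 2
  filter_upwards [ae_lt_top hmeas
    (h.trans_lt (ENNReal.mul_lt_top (ENNReal.pow_lt_top hfin.lt_top) hB.lt_top)).ne] with s hs
  refine ⟨((hm.of_uncurry_left).mul
    (continuous_gaussianWeight L).measurable).aestronglyMeasurable, ?_⟩
  have hs' : (∫⁻ v, ‖gaussianWeight L v‖ₑ * ‖meanNoise f σ t τ ε s v‖ₑ) ≠ ∞ := fun h => by
    simp [h] at hs
  rw [HasFiniteIntegral]
  simpa only [enorm_mul, mul_comm] using hs'.lt_top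

/-- The constant in the bound for the second moment of the error of the smoothed data. -/
def dataErrorConst (K R L₀ : ℝ) : ℝ :=
  9 * dilatedDataConst K R ^ 2 + 3 * ((3 + R) * (8 * K)) ^ 2 +
    3 * ((3 * L₀ + R) ^ 2 * (9 * ((1 + 9 * K) * noiseConst)))

lemma noiseConst_nonneg : 0 ≤ noiseConst := by
  have := gaussianFourthMoment_nonneg
  unfold noiseConst; positivity

/-- The bandwidth satisfies `L⁶ = σ⁴ / M`, which balances the squared bias `L⁴` of the smoothing
against the variance `L⁻² σ⁴ / M` of the derivative of the smoothed noise. -/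
lemma lintegral_dataError_sq_le [IsProbabilityMeasure P] (hM : 0 < M) (h0 : 0 < η)
    (h1 : η ^ 2 ≤ 1 / 12) (hσ : 1 ≤ σ) (hL : 0 < L) {L₀ : ℝ} (hLL : L ≤ L₀)
    (hLσ : σ ^ 4 / M = L ^ 6) (hmodel : IsNoisyDilationMRA f M η σ t τ ε P)
    (hc : Continuous (fourier f)) {K : ℝ} {p₁ p₂ p₃ : ℝ → ℝ}
    (hp : BoundedDerivs K (powerSpectrum f) p₁ p₂ p₃) {R u : ℝ} (hu : |u| ≤ R) :
    ∫⁻ s, ‖dataError η L (powerSpectrum f) (modelData f σ t τ ε) s u‖ₑ ^ 2 ∂P ≤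
      ENNReal.ofReal (dataErrorConst K R L₀ * (η ^ 2 / M + L ^ 4)) := by
  have hR : 0 ≤ R := (abs_nonneg u).trans hu
  have hK := hp.nonneg
  have hnc := noiseConst_nonneg
  have hM' : (0 : ℝ) < M := by exact_mod_cast hM
  set BN : ℝ := 9 * ((1 + 9 * K) * noiseConst) with hBN
  have hBN0 : 0 ≤ BN := by positivity
  have hN : ∀ v, ∫⁻ s, ‖meanNoise f σ t τ ε s v‖ₑ ^ 2 ∂P ≤ ENNReal.ofReal (BN * L ^ 6) :=
    fun v => hLσ ▸ lintegral_meanNoise_sq_le hM h1 hσ hmodel hc hp.bound₀ v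
  have hmN : Measurable (Function.uncurry (meanNoise f σ t τ ε)) :=
    measurable_meanNoise hc hmodel.measurable_t hmodel.measurable_τ
      fun j => (hmodel.whiteNoise j).measurable_fourier
  let T : S → ℝ≥0∞ := fun s => ‖(1 / (M : ℝ)) * ∑ j,
    (dilatedData (powerSpectrum f) p₁ u (1 - τ j s) - meanUnbiasData η (powerSpectrum f) u)‖ₑ
  let b : ℝ≥0∞ := ENNReal.ofReal ((3 + R) * (8 * K) * L ^ 2)
  let Z : S → ℝ≥0∞ := fun s =>
    ∫⁻ v, ENNReal.ofReal (noiseWeight L R u v) * ‖meanNoise f σ t τ ε s v‖ₑ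
  have hW : Measurable fun v => ENNReal.ofReal (noiseWeight L R u v) :=
    (continuous_noiseWeight L R u).measurable.ennreal_ofReal
  have hT : Measurable T := by
    have hd : Measurable (dilatedData (powerSpectrum f) p₁ u) :=
      (continuous_dilatedData hp u).measurable
    refine (Measurable.const_mul (Finset.measurable_sum _ fun j _ => ?_) _).enorm
    exact (hd.comp ((hmodel.measurable_τ j).const_sub 1)).sub_const _
  have hZ : Measurable Z := Measurable.lintegral_prod_right (ν := volume)
    ((hW.comp measurable_snd).mul hmN.enorm)
  have hbound : ∀ᵐ s ∂P, ‖dataError η L (powerSpectrum f) (modelData f σ t τ ε) s u‖ₑ ^ 2 ≤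
      3 * (T s ^ 2 + b ^ 2 + Z s ^ 2) := by
    filter_upwards [ae_integrable_meanNoise hL hmN ENNReal.ofReal_ne_top hN,
      ae_all_iff.2 fun j => ae_mem_Icc_of_uniform (hmodel.measurable_τ j) (hmodel.uniform_τ j)]
      with s hs hτ
    have hx := fun j => one_sub_mem_Icc h1 (hτ j)
    have hq := hp.average hM hx
    have hNs : Measurable (meanNoise f σ t τ ε s) := hmN.of_uncurry_left
    have hint : Integrable fun v => modelData f σ t τ ε s v * gaussianWeight L v := by
      simp only [modelData, add_mul]
      exact (hq.integrable_mul_gaussianWeight hL).add hs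
    have hmd : Measurable (modelData f σ t τ ε s) := hq.continuous₀.measurable.add hNs
    rw [dataError_eq hL hmd hint]
    exact (pow_le_pow_left' (enorm_meanUnbiasData_sub_le hp hM hL hx hNs hs hu) 2).trans
      (add_add_sq_le _ _ _)
  have e1 : ∫⁻ s, T s ^ 2 ∂P ≤ ENNReal.ofReal (dilatedDataConst K R ^ 2 * (3 * η ^ 2) / M) :=
    lintegral_average_dilatedData_le hM h0 h1 hp hmodel.measurable_τ hmodel.indep_τ
      hmodel.uniform_τ hu
  have e3 : ∫⁻ s, Z s ^ 2 ∂P ≤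
      ENNReal.ofReal (3 + R * L⁻¹) ^ 2 * ENNReal.ofReal (BN * L ^ 6) :=
    (lintegral_sq_lintegral_mul_le P volume hW (X := fun s v => ‖meanNoise f σ t τ ε s v‖ₑ)
      hmN.enorm fun v _ => hN v).trans (by gcongr; exact lintegral_noiseWeight_le hL hR u)
  calc _ ≤ ∫⁻ s, 3 * (T s ^ 2 + b ^ 2 + Z s ^ 2) ∂P := lintegral_mono_ae hbound
    _ = 3 * ((∫⁻ s, T s ^ 2 ∂P) + b ^ 2 + ∫⁻ s, Z s ^ 2 ∂P) := by
        have hTb : Measurable fun s => T s ^ 2 + b ^ 2 := (hT.pow_const 2).add_const _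
        have hsum : Measurable fun s => T s ^ 2 + b ^ 2 + Z s ^ 2 := hTb.add (hZ.pow_const 2)
        rw [lintegral_const_mul _ hsum,
          lintegral_add_right _ (hZ.pow_const 2), lintegral_add_right _ measurable_const,
          lintegral_const, measure_univ, mul_one]
    _ ≤ 3 * (ENNReal.ofReal (dilatedDataConst K R ^ 2 * (3 * η ^ 2) / M) +
          ENNReal.ofReal ((3 + R) * (8 * K) * L ^ 2) ^ 2 +
          ENNReal.ofReal (3 + R * L⁻¹) ^ 2 * ENNReal.ofReal (BN * L ^ 6)) := by
        gcongr
    _ = ENNReal.ofReal (3 * (dilatedDataConst K R ^ 2 * (3 * η ^ 2) / M +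
          ((3 + R) * (8 * K) * L ^ 2) ^ 2 + (3 + R * L⁻¹) ^ 2 * (BN * L ^ 6))) := by
        rw [← ENNReal.ofReal_pow (by positivity), ← ENNReal.ofReal_pow (by positivity),
          ← ENNReal.ofReal_mul (by positivity), ← ENNReal.ofReal_add (by positivity)
          (by positivity), ← ENNReal.ofReal_add (by positivity) (by positivity),
          ENNReal.ofReal_mul (by norm_num), ENNReal.ofReal_ofNat]
    _ ≤ _ := by
        refine ENNReal.ofReal_le_ofReal ?_
        have hx : (3 + R * L⁻¹) ^ 2 * (BN * L ^ 6) = (3 * L + R) ^ 2 * BN * L ^ 4 := by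
          field_simp
        have hy : (3 * L + R) ^ 2 * BN * L ^ 4 ≤ (3 * L₀ + R) ^ 2 * BN * L ^ 4 := by gcongr
        rw [hx, dataErrorConst, ← hBN]
        have h4 : 0 ≤ L ^ 4 := by positivity
        have h5 : 0 ≤ η ^ 2 / M := by positivity
        have z1 : 0 ≤ dilatedDataConst K R ^ 2 * L ^ 4 := by positivity
        have z2 : 0 ≤ ((3 + R) * (8 * K)) ^ 2 * (η ^ 2 / M) := by positivity
        have z3 : 0 ≤ (3 * L₀ + R) ^ 2 * BN * (η ^ 2 / M) := by positivity
        have z4 : dilatedDataConst K R ^ 2 * (3 * η ^ 2) / M =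
          3 * (dilatedDataConst K R ^ 2 * (η ^ 2 / M)) := by ring
        rw [z4]
        linarith

end

end DilationMRA

end

theorem corollary1
    -- the hidden signal and the regularity and decay of its power spectrum
    (f : ℝ → ℝ) (hf : HasCompactSupport f) (hf2 : MemLp f 2 volume)
    (hC3 : ContDiff ℝ 3 (DilationMRA.powerSpectrum f))
    (hdecay : ∀ k ∈ ({2, 3} : Set ℕ),
      MemLp (fun ω : ℝ => ω ^ k * DilationMRA.envelope (DilationMRA.powerSpectrum f) k ω) 2 volume)
    -- the finite frequency interval
    (Ω : Set ℝ) (hΩ : Ω.OrdConnected) (hΩb : Bornology.IsBounded Ω)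
    -- an arbitrary upper bound for the bandwidth
    (L₀ : ℝ) (hL₀ : 0 < L₀) :
    ∃ C : ℝ, 0 < C ∧
      ∀ (M : ℕ) (η σ L : ℝ), 0 < M → 0 < η → η ^ 2 ≤ 1 / 12 → 1 ≤ σ →
        L = (σ ^ 4 / (M : ℝ)) ^ ((1 : ℝ) / 6) → L ≤ L₀ →
      ∀ (S : Type*) (_ : MeasurableSpace S) (P : Measure S) (_ : IsProbabilityMeasure P)
        (t τ : Fin M → S → ℝ) (ε : Fin M → DilationMRA.BoxL2 → S → ℝ),
        DilationMRA.IsNoisyDilationMRA f M η σ t τ ε P →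
          (∀ᵐ s ∂P, DilationMRA.InversionWellDefined η L
            (DilationMRA.meanPowerSpectrum f σ t τ ε s)) ∧
          AEMeasurable (DilationMRA.estimationError f Ω η σ L t τ ε) P ∧
          ∫⁻ s, (DilationMRA.estimationError f Ω η σ L t τ ε s) ^ 2 ∂P ≤
            ENNReal.ofReal (C * (η ^ 2 / (M : ℝ) + (σ ^ 4 / (M : ℝ)) ^ ((2 : ℝ) / 3))) := by
  open DilationMRA in
  have hi := integrable_mul_pow hf hf2
  obtain ⟨K, p₁, p₂, p₃, hp⟩ := exists_boundedDerivs_powerSpectrum hi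
  have hc := continuous_fourier hi
  have hK := hp.nonneg
  have hnc := noiseConst_nonneg
  obtain ⟨R, hR, hΩR⟩ : ∃ R : ℝ, 0 < R ∧ Ω ⊆ Icc (-R) R := by
    obtain ⟨R, hR0, hR⟩ := hΩb.subset_closedBall_lt 0 0
    exact ⟨R, hR0, by simpa [Real.closedBall_eq_Icc] using hR⟩
  set A := dataErrorConst K R L₀ with hA
  have hA0 : 0 ≤ A := by rw [hA, dataErrorConst]; positivity
  refine ⟨2 * R * (9 / 4 * A) + 1, by positivity, ?_⟩
  intro M η σ L hM h0 h1 hσ hL hLL S _ P _ t τ ε hmodel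
  have hM' : (0 : ℝ) < M := by exact_mod_cast hM
  have hr : 0 < σ ^ 4 / (M : ℝ) := by positivity
  have hLpos : 0 < L := hL ▸ Real.rpow_pos_of_pos hr _
  have hL6 : σ ^ 4 / (M : ℝ) = L ^ 6 := by
    rw [hL, ← Real.rpow_natCast (_ ^ ((1 : ℝ) / 6)), ← Real.rpow_mul hr.le]
    norm_num
  have hL4 : (σ ^ 4 / (M : ℝ)) ^ ((2 : ℝ) / 3) = L ^ 4 := by
    rw [hL, ← Real.rpow_natCast (_ ^ ((1 : ℝ) / 6)), ← Real.rpow_mul hr.le]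
    norm_num
  set h := modelData f σ t τ ε with hh
  have hmN : Measurable (Function.uncurry (meanNoise f σ t τ ε)) :=
    measurable_meanNoise hc hmodel.measurable_t hmodel.measurable_τ
      fun j => (hmodel.whiteNoise j).measurable_fourier
  have hhm : Measurable (Function.uncurry h) :=
    (measurable_meanSignal hc hmodel.measurable_τ).add hmN
  have hpm : Measurable (powerSpectrum f) := hp.continuous₀.measurable
  have hgood : ∀ᵐ s ∂P, meanPowerSpectrum f σ t τ ε s = h s ∧ Measurable (h s) ∧
      Integrable fun v => h s v * gaussianWeight L v := by
    filter_upwards [ae_integrable_meanNoise hLpos hmN ENNReal.ofReal_ne_top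
      (fun v => lintegral_meanNoise_sq_le hM h1 hσ hmodel hc hp.bound₀ v),
      ae_all_iff.2 fun j => ae_mem_Icc_of_uniform (hmodel.measurable_τ j) (hmodel.uniform_τ j)]
      with s hs hτ
    have hx := fun j => one_sub_mem_Icc h1 (hτ j)
    have hq := hp.average hM hx
    refine ⟨meanPowerSpectrum_eq hM fun j => by linarith [(hx j).1],
      hhm.of_uncurry_left, ?_⟩
    simp only [hh, modelData, add_mul]
    exact (hq.integrable_mul_gaussianWeight hLpos).add hs
  have herr : ∀ᵐ s ∂P, estimationError f Ω η σ L t τ ε s =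
      (∫⁻ ω in Ω, ‖inversionError η L (powerSpectrum f) h s ω‖ₑ ^ 2) ^ (1 / 2 : ℝ) := by
    filter_upwards [hgood] with s ⟨hs1, hs2, hs3⟩
    rw [estimationError, eLpNorm_eq_lintegral_rpow_enorm_toReal (by norm_num) (by norm_num)]
    simp only [estimator, hs1, ENNReal.toReal_ofNat, ENNReal.rpow_two,
      ← inversionError_eq hLpos h0 h1 hs2 hs3 hp.bound₀]
  have hEm := measurable_inversionError (η := η) (L := L) hpm hhm
  refine ⟨?_, ?_, ?_⟩
  · filter_upwards [hgood] with s ⟨hs1, hs2, hs3⟩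
    rw [hs1]
    exact inversionWellDefined hLpos h0 h1 hs2 hs3
  · refine AEMeasurable.congr ?_ (Filter.EventuallyEq.symm herr)
    exact ((hEm.enorm.pow_const 2).lintegral_prod_right.pow_const _).aemeasurable
  · rw [hL4]
    calc ∫⁻ s, (estimationError f Ω η σ L t τ ε s) ^ 2 ∂P
        = ∫⁻ s, (∫⁻ ω in Ω, ‖inversionError η L (powerSpectrum f) h s ω‖ₑ ^ 2) ∂P := by
          refine lintegral_congr_ae ?_
          filter_upwards [herr] with s hs
          rw [hs, ← ENNReal.rpow_natCast, ← ENNReal.rpow_mul]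
          norm_num
      _ ≤ ∫⁻ s, (∫⁻ ω in Icc (-R) R, ‖inversionError η L (powerSpectrum f) h s ω‖ₑ ^ 2) ∂P :=
          lintegral_mono fun s => lintegral_mono_set hΩR
      _ ≤ ENNReal.ofReal (2 * R) *
          (ENNReal.ofReal (9 / 4) * ENNReal.ofReal (A * (η ^ 2 / M + L ^ 4))) :=
          lintegral_inversionError_sq_le h0 h1 hpm hhm fun u hu =>
            lintegral_dataError_sq_le hM h0 h1 hσ hLpos hLL hL6 hmodel hc hp hu
      _ = ENNReal.ofReal (2 * R * (9 / 4 * A) * (η ^ 2 / M + L ^ 4)) := by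
          rw [← ENNReal.ofReal_mul (by norm_num), ← ENNReal.ofReal_mul (by positivity)]
          ring_nf
      _ ≤ _ := by
          refine ENNReal.ofReal_le_ofReal (mul_le_mul_of_nonneg_right ?_ (by positivity))
          linarith
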